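/- Let $\Bbbk$ be a field. All Hopf monoids are connected Hopf monoids in vector species over $\Bbbk$ (connected bimonoids: natural, (co)associative, (co)unital products $\mu_{I,J}:\mathbf H[I]\otimes \mathbf H[J]\to \mathbf H[I\sqcup J]$ and coproducts $\Delta_{I,J}:\mathbf H[I\sqcup J]\to \mathbf H[I]\otimes \mathbf H[J]$ that are compatible with each other, with $\mathbf H[\emptyset]=\Bbbk$). For a finite set $I$: * $\mathbf L^*[I]$ is the vector space with basis the linear orders on $I$; $\mu_{I,J}(w\otimes u)=\sum_v v$ over all linear orders $v$ on $I\sqcup J$ with $v|_I=w$ and $v|_J=u$ (shuffles); $\Delta_{I,J}(v)=v|_I\otimes v|_J$ if $I$ is an initial segment of $v$, and $0$ otherwise. * $\mathbf{GP}[I]$ is the vector space with basis the generalized permutahedra in $\mathbb R^I$, i.e. the nonempty polytopes $\mathfrak p\subset\mathbb R^I$ whose normal fan is a coarsening of the braid fan; $\mu_{I,J}(\mathfrak p\otimes\mathfrak q)=\mathfrak p\times\mathfrak q$ and $\Delta_{I,J}(\mathfrak p)=\mathfrak p|I\otimes\mathfrak p/I$, where $\mathfrak p|I\subset\mathbb R^I$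 and $\mathfrak p/I\subset\mathbb R^J$ are the generalized permutahedra such that $\mathfrak p|I\times\mathfrak p/I$ is the face of $\mathfrak p\subset\mathbb R^{I\sqcup J}$ on which the functional $y\mapsto\sum_{i\in I}y_i$ is maximal. * $\mathbf{OGP}=\mathbf L^*\times\mathbf{GP}$ is the Hadamard product: $\mathbf{OGP}[I]=\mathbf L^*[I]\otimes\mathbf{GP}[I]$, with componentwise product and coproduct. Then the symmetrization map $\mathrm{Symm}:\mathbf{GP}\to\mathbf{OGP}$, given for each finite set $I$ by the linear map $\mathbf{GP}[I]\to\mathbf{OGP}[I]$ with $$\mathrm{Symm}(\mathfrak p)=\sum_{w}w\otimes\mathfrak p\qquad\text{(sum over all linear orders $w$ on $I$)}$$ for generalized permutahedra $\mathfrak p\subset\mathbb R^I$, is an injective morphism of Hopf monoids: it is natural in $I$, respects products, units, coproducts and counits, and every component $\mathbf{GP}[I]\to\mathbf{OGP}[I]$ is injective. -/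

import Mathlib

open scoped TensorProduct

universe u v w w'

/-- A vector species over `k`: a functor from finite sets and bijections to `k`-vector spaces. -/
structure VectorSpecies (k : Type v) [Field k] where
  obj : (I : Type u) → [Fintype I] → Type w
  [addCommGroup : ∀ (I : Type u) [Fintype I], AddCommGroup (obj I)]
  [module : ∀ (I : Type u) [Fintype I], Module k (obj I)]
  map : ∀ {I J : Type u} [Fintype I] [Fintype J], (I ≃ J) → (obj I →ₗ[k] obj J)
  map_refl : ∀ (I : Type u) [Fintype I] (x : obj I), map (Equiv.refl I) x = x
  map_trans : ∀ {I J K : Type u} [Fintype I] [Fintype J] [Fintype K] (σ : I ≃ J) (τ : J ≃ K)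
    (x : obj I), map (σ.trans τ) x = map τ (map σ x)

attribute [instance] VectorSpecies.addCommGroup VectorSpecies.module

/-- A connected Hopf monoid in vector species, i.e. a connected bimonoid (the antipode then exists
automatically). Disjoint unions are modelled by `⊕` and the empty set by `PEmpty`. A morphism of
species between the unit species and `H` amounts to a linear map between `k` and `H[∅]`; so the
unit is given by the element `one` (the image of `1 : k`) and the counit by `counit`. -/
structure ConnectedHopfMonoid (k : Type v) [Field k] extends VectorSpecies.{u, v, w} k where
  mul : ∀ (I J : Type u) [Fintype I] [Fintype J], obj I ⊗[k] obj J →ₗ[k] obj (I ⊕ J)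
  one : obj PEmpty
  comul : ∀ (I J : Type u) [Fintype I] [Fintype J], obj (I ⊕ J) →ₗ[k] obj I ⊗[k] obj J
  counit : obj PEmpty →ₗ[k] k
  /-- naturality of the product -/
  mul_natural : ∀ {I J I' J' : Type u} [Fintype I] [Fintype J] [Fintype I'] [Fintype J']
    (σ : I ≃ I') (τ : J ≃ J') (x : obj I) (y : obj J),
    map (Equiv.sumCongr σ τ) (mul I J (x ⊗ₜ y)) = mul I' J' (map σ x ⊗ₜ map τ y)
  /-- naturality of the coproduct -/
  comul_natural : ∀ {I J I' J' : Type u} [Fintype I] [Fintype J] [Fintype I'] [Fintype J']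
    (σ : I ≃ I') (τ : J ≃ J') (x : obj (I ⊕ J)),
    comul I' J' (map (Equiv.sumCongr σ τ) x) = TensorProduct.map (map σ) (map τ) (comul I J x)
  mul_assoc : ∀ (I J K : Type u) [Fintype I] [Fintype J] [Fintype K]
    (x : obj I) (y : obj J) (z : obj K),
    map (Equiv.sumAssoc I J K) (mul (I ⊕ J) K (mul I J (x ⊗ₜ y) ⊗ₜ z)) =
      mul I (J ⊕ K) (x ⊗ₜ mul J K (y ⊗ₜ z))
  one_mul : ∀ (I : Type u) [Fintype I] (x : obj I),
    map (Equiv.emptySum PEmpty I) (mul PEmpty I (one ⊗ₜ x)) = x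
  mul_one : ∀ (I : Type u) [Fintype I] (x : obj I),
    map (Equiv.sumEmpty I PEmpty) (mul I PEmpty (x ⊗ₜ one)) = x
  comul_coassoc : ∀ (I J K : Type u) [Fintype I] [Fintype J] [Fintype K] (x : obj ((I ⊕ J) ⊕ K)),
    TensorProduct.assoc k (obj I) (obj J) (obj K)
        (TensorProduct.map (comul I J) LinearMap.id (comul (I ⊕ J) K x)) =
      TensorProduct.map LinearMap.id (comul J K)
        (comul I (J ⊕ K) (map (Equiv.sumAssoc I J K) x))
  counit_comul : ∀ (I : Type u) [Fintype I] (x : obj (PEmpty ⊕ I)),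
    TensorProduct.lid k (obj I) (TensorProduct.map counit LinearMap.id (comul PEmpty I x)) =
      map (Equiv.emptySum PEmpty I) x
  comul_counit : ∀ (I : Type u) [Fintype I] (x : obj (I ⊕ PEmpty)),
    TensorProduct.rid k (obj I) (TensorProduct.map LinearMap.id counit (comul I PEmpty x)) =
      map (Equiv.sumEmpty I PEmpty) x
  /-- compatibility of product and coproduct, for the decompositions
  `(A ⊔ B) ⊔ (C ⊔ D) = (A ⊔ C) ⊔ (B ⊔ D)` of one set -/
  comul_mul : ∀ (A B C D : Type u) [Fintype A] [Fintype B] [Fintype C] [Fintype D]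
    (x : obj (A ⊕ B)) (y : obj (C ⊕ D)),
    comul (A ⊕ C) (B ⊕ D) (map (Equiv.sumSumSumComm A B C D) (mul (A ⊕ B) (C ⊕ D) (x ⊗ₜ y))) =
      TensorProduct.map (mul A C) (mul B D)
        (TensorProduct.tensorTensorTensorComm k (obj A) (obj B) (obj C) (obj D)
          (comul A B x ⊗ₜ comul C D y))
  comul_one : comul PEmpty PEmpty (map (Equiv.emptySum PEmpty PEmpty).symm one) = one ⊗ₜ one
  counit_mul : ∀ x y : obj PEmpty,
    counit (map (Equiv.emptySum PEmpty PEmpty) (mul PEmpty PEmpty (x ⊗ₜ y))) =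
      counit x * counit y
  counit_one : counit one = 1
  /-- connectedness: the unit identifies `k` with `H[∅]` -/
  connected : ∀ x : obj PEmpty, counit x • one = x

/-- A morphism of Hopf monoids: a natural family of linear maps that respects products, units,
coproducts and counits. -/
structure IsHopfMorphism {k : Type v} [Field k] (H : ConnectedHopfMonoid.{u, v, w} k)
    (K : ConnectedHopfMonoid.{u, v, w'} k)
    (f : ∀ (I : Type u) [Fintype I], H.obj I →ₗ[k] K.obj I) : Prop where
  natural : ∀ {I J : Type u} [Fintype I] [Fintype J] (σ : I ≃ J) (x : H.obj I),
    f J (H.map σ x) = K.map σ (f I x)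
  map_mul : ∀ (I J : Type u) [Fintype I] [Fintype J] (x : H.obj I) (y : H.obj J),
    f (I ⊕ J) (H.mul I J (x ⊗ₜ y)) = K.mul I J (f I x ⊗ₜ f J y)
  map_one : f PEmpty H.one = K.one
  map_comul : ∀ (I J : Type u) [Fintype I] [Fintype J] (x : H.obj (I ⊕ J)),
    K.comul I J (f (I ⊕ J) x) = TensorProduct.map (f I) (f J) (H.comul I J x)
  map_counit : ∀ x : H.obj PEmpty, K.counit (f PEmpty x) = H.counit x

section Hadamard

variable {k : Type v} [Field k]

theorem hadamard_coassoc_left {A B A' B' A₁ A₂ A₁' A₂' : Type*}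
    [AddCommGroup A] [AddCommGroup B] [AddCommGroup A'] [AddCommGroup B']
    [AddCommGroup A₁] [AddCommGroup A₂] [AddCommGroup A₁'] [AddCommGroup A₂']
    [Module k A] [Module k B] [Module k A'] [Module k B']
    [Module k A₁] [Module k A₂] [Module k A₁'] [Module k A₂']
    (d : A →ₗ[k] A₁ ⊗[k] A₂) (d' : A' →ₗ[k] A₁' ⊗[k] A₂') (a : A ⊗[k] B) (b : A' ⊗[k] B') :
    TensorProduct.assoc k (A₁ ⊗[k] A₁') (A₂ ⊗[k] A₂') (B ⊗[k] B')
      (TensorProduct.map ((TensorProduct.tensorTensorTensorComm k A₁ A₂ A₁' A₂').toLinearMap ∘ₗ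
        TensorProduct.map d d') LinearMap.id
        (TensorProduct.tensorTensorTensorComm k A B A' B' (a ⊗ₜ b))) =
      TensorProduct.map LinearMap.id
        (TensorProduct.tensorTensorTensorComm k A₂ B A₂' B').toLinearMap
        (TensorProduct.tensorTensorTensorComm k A₁ (A₂ ⊗[k] B) A₁' (A₂' ⊗[k] B')
          (TensorProduct.assoc k A₁ A₂ B (TensorProduct.map d LinearMap.id a) ⊗ₜ
            TensorProduct.assoc k A₁' A₂' B' (TensorProduct.map d' LinearMap.id b))) := by
  induction a with
  | zero => simp
  | add x y hx hy => simp only [TensorProduct.add_tmul, map_add, hx, hy]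
  | tmul a₀ b₀ =>
    induction b with
    | zero => simp
    | add x y hx hy => simp only [TensorProduct.tmul_add, map_add, hx, hy]
    | tmul a₁ b₁ =>
      simp only [TensorProduct.tensorTensorTensorComm_tmul, TensorProduct.map_tmul,
        LinearMap.comp_apply, LinearMap.id_apply, LinearEquiv.coe_coe]
      generalize d a₀ = s
      generalize d' a₁ = t
      induction s with
      | zero => simp
      | add x y hx hy => simp only [TensorProduct.add_tmul, map_add, hx, hy]
      | tmul _ _ =>
        induction t with
        | zero => simp
        | add x y hx hy => simp only [TensorProduct.add_tmul, TensorProduct.tmul_add, map_add, hx, hy]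
        | tmul _ _ => simp

theorem hadamard_map_tensorComm {A B A' B' C D C' D' : Type*}
    [AddCommGroup A] [AddCommGroup B] [AddCommGroup A'] [AddCommGroup B']
    [AddCommGroup C] [AddCommGroup D] [AddCommGroup C'] [AddCommGroup D']
    [Module k A] [Module k B] [Module k A'] [Module k B']
    [Module k C] [Module k D] [Module k C'] [Module k D']
    (f : A →ₗ[k] C) (g : B →ₗ[k] D) (f' : A' →ₗ[k] C') (g' : B' →ₗ[k] D')
    (a : A ⊗[k] B) (b : A' ⊗[k] B') :
    TensorProduct.map (TensorProduct.map f f') (TensorProduct.map g g')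
        (TensorProduct.tensorTensorTensorComm k A B A' B' (a ⊗ₜ b)) =
      TensorProduct.tensorTensorTensorComm k C D C' D'
        (TensorProduct.map f g a ⊗ₜ TensorProduct.map f' g' b) := by
  induction a with
  | zero => simp
  | add x y hx hy => simp only [TensorProduct.add_tmul, map_add, hx, hy]
  | tmul a₀ b₀ =>
    induction b with
    | zero => simp
    | add x y hx hy => simp only [TensorProduct.tmul_add, map_add, hx, hy]
    | tmul a₁ b₁ => simp

theorem hadamard_lid {A A' U U' : Type*}
    [AddCommGroup A] [AddCommGroup A'] [AddCommGroup U] [AddCommGroup U']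
    [Module k A] [Module k A'] [Module k U] [Module k U']
    (e : U →ₗ[k] k) (e' : U' →ₗ[k] k) (a : U ⊗[k] A) (b : U' ⊗[k] A') :
    TensorProduct.lid k (A ⊗[k] A')
      (TensorProduct.map ((TensorProduct.lid k k).toLinearMap ∘ₗ TensorProduct.map e e')
        LinearMap.id (TensorProduct.tensorTensorTensorComm k U A U' A' (a ⊗ₜ b))) =
      TensorProduct.lid k A (TensorProduct.map e LinearMap.id a) ⊗ₜ
        TensorProduct.lid k A' (TensorProduct.map e' LinearMap.id b) := by
  induction a with
  | zero => simp
  | add x y hx hy => simp only [TensorProduct.add_tmul, map_add, hx, hy]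
  | tmul a₀ b₀ =>
    induction b with
    | zero => simp
    | add x y hx hy => simp only [TensorProduct.tmul_add, map_add, hx, hy]
    | tmul a₁ b₁ => simp [← TensorProduct.smul_tmul', smul_smul, mul_comm]

theorem hadamard_rid {A A' U U' : Type*}
    [AddCommGroup A] [AddCommGroup A'] [AddCommGroup U] [AddCommGroup U']
    [Module k A] [Module k A'] [Module k U] [Module k U']
    (e : U →ₗ[k] k) (e' : U' →ₗ[k] k) (a : A ⊗[k] U) (b : A' ⊗[k] U') :
    TensorProduct.rid k (A ⊗[k] A')
      (TensorProduct.map LinearMap.id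
        ((TensorProduct.lid k k).toLinearMap ∘ₗ TensorProduct.map e e')
        (TensorProduct.tensorTensorTensorComm k A U A' U' (a ⊗ₜ b))) =
      TensorProduct.rid k A (TensorProduct.map LinearMap.id e a) ⊗ₜ
        TensorProduct.rid k A' (TensorProduct.map LinearMap.id e' b) := by
  induction a with
  | zero => simp
  | add x y hx hy => simp only [TensorProduct.add_tmul, map_add, hx, hy]
  | tmul a₀ b₀ =>
    induction b with
    | zero => simp
    | add x y hx hy => simp only [TensorProduct.tmul_add, map_add, hx, hy]
    | tmul a₁ b₁ => simp [← TensorProduct.smul_tmul', smul_smul, mul_comm]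

theorem hadamard_comul_mul {A B C D A' B' C' D' M N M' N' : Type*}
    [AddCommGroup A] [AddCommGroup B] [AddCommGroup C] [AddCommGroup D]
    [AddCommGroup A'] [AddCommGroup B'] [AddCommGroup C'] [AddCommGroup D']
    [AddCommGroup M] [AddCommGroup N] [AddCommGroup M'] [AddCommGroup N']
    [Module k A] [Module k B] [Module k C] [Module k D]
    [Module k A'] [Module k B'] [Module k C'] [Module k D']
    [Module k M] [Module k N] [Module k M'] [Module k N']
    (m : A ⊗[k] C →ₗ[k] M) (n : B ⊗[k] D →ₗ[k] N)
    (m' : A' ⊗[k] C' →ₗ[k] M') (n' : B' ⊗[k] D' →ₗ[k] N')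
    (a : A ⊗[k] B) (c : C ⊗[k] D) (a' : A' ⊗[k] B') (c' : C' ⊗[k] D') :
    TensorProduct.tensorTensorTensorComm k M N M' N'
      (TensorProduct.map m n (TensorProduct.tensorTensorTensorComm k A B C D (a ⊗ₜ c)) ⊗ₜ
        TensorProduct.map m' n' (TensorProduct.tensorTensorTensorComm k A' B' C' D' (a' ⊗ₜ c'))) =
    TensorProduct.map
      (TensorProduct.map m m' ∘ₗ (TensorProduct.tensorTensorTensorComm k A A' C C').toLinearMap)
      (TensorProduct.map n n' ∘ₗ (TensorProduct.tensorTensorTensorComm k B B' D D').toLinearMap)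
      (TensorProduct.tensorTensorTensorComm k (A ⊗[k] A') (B ⊗[k] B') (C ⊗[k] C') (D ⊗[k] D')
        (TensorProduct.tensorTensorTensorComm k A B A' B' (a ⊗ₜ a') ⊗ₜ
          TensorProduct.tensorTensorTensorComm k C D C' D' (c ⊗ₜ c'))) := by
  induction a with
  | zero => simp
  | add x y hx hy => simp only [TensorProduct.add_tmul, TensorProduct.tmul_add, map_add, hx, hy]
  | tmul _ _ =>
  induction c with
  | zero => simp
  | add x y hx hy => simp only [TensorProduct.add_tmul, TensorProduct.tmul_add, map_add, hx, hy]
  | tmul _ _ =>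
  induction a' with
  | zero => simp
  | add x y hx hy => simp only [TensorProduct.add_tmul, TensorProduct.tmul_add, map_add, hx, hy]
  | tmul _ _ =>
  induction c' with
  | zero => simp
  | add x y hx hy => simp only [TensorProduct.add_tmul, TensorProduct.tmul_add, map_add, hx, hy]
  | tmul _ _ => simp

/-- The Hadamard product of two Hopf monoids: `(H × K)[I] = H[I] ⊗ K[I]`, with componentwise
structure. -/
@[reducible] noncomputable def hadamard (H : ConnectedHopfMonoid.{u, v, w} k)
    (K : ConnectedHopfMonoid.{u, v, w'} k) : ConnectedHopfMonoid.{u, v, max w w'} k where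
  obj I _ := H.obj I ⊗[k] K.obj I
  map σ := TensorProduct.map (H.map σ) (K.map σ)
  mul I J _ _ := TensorProduct.map (H.mul I J) (K.mul I J) ∘ₗ
    (TensorProduct.tensorTensorTensorComm k (H.obj I) (K.obj I) (H.obj J) (K.obj J)).toLinearMap
  one := H.one ⊗ₜ K.one
  comul I J _ _ :=
    (TensorProduct.tensorTensorTensorComm k (H.obj I) (H.obj J) (K.obj I) (K.obj J)).toLinearMap ∘ₗ
      TensorProduct.map (H.comul I J) (K.comul I J)
  counit := (TensorProduct.lid k k).toLinearMap ∘ₗ TensorProduct.map H.counit K.counit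
  map_refl I _ x := by
    induction x with
    | zero => simp
    | add x y hx hy => simp only [map_add, hx, hy]
    | tmul a b => simp [H.map_refl, K.map_refl]
  map_trans σ τ x := by
    induction x with
    | zero => simp
    | add x y hx hy => simp only [map_add, hx, hy]
    | tmul a b => simp [H.map_trans, K.map_trans]
  mul_natural σ τ x y := by
    induction x with
    | zero => simp
    | add x y hx hy => simp only [TensorProduct.add_tmul, map_add, hx, hy]
    | tmul a b =>
      induction y with
      | zero => simp
      | add x y hx hy => simp only [TensorProduct.tmul_add, map_add, hx, hy]
      | tmul c d => simp [H.mul_natural, K.mul_natural]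
  comul_natural σ τ x := by
    induction x with
    | zero => simp
    | add x y hx hy => simp only [map_add, hx, hy]
    | tmul a b =>
      simp [H.comul_natural, K.comul_natural, hadamard_map_tensorComm]
  mul_assoc I J K' _ _ _ x y z := by
    induction x with
    | zero => simp
    | add x y hx hy => simp only [TensorProduct.add_tmul, map_add, hx, hy]
    | tmul a b =>
    induction y with
    | zero => simp
    | add x y hx hy => simp only [TensorProduct.add_tmul, TensorProduct.tmul_add, map_add, hx, hy]
    | tmul c d =>
    induction z with
    | zero => simp
    | add x y hx hy => simp only [TensorProduct.tmul_add, map_add, hx, hy]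
    | tmul e f => simp [H.mul_assoc, K.mul_assoc]
  one_mul I _ x := by
    induction x with
    | zero => simp
    | add x y hx hy => simp only [TensorProduct.tmul_add, map_add, hx, hy]
    | tmul a b => simp [H.one_mul, K.one_mul]
  mul_one I _ x := by
    induction x with
    | zero => simp
    | add x y hx hy => simp only [TensorProduct.add_tmul, map_add, hx, hy]
    | tmul a b => simp [H.mul_one, K.mul_one]
  comul_coassoc I J K' _ _ _ x := by
    induction x with
    | zero => simp
    | add x y hx hy => simp only [map_add, hx, hy]
    | tmul a b =>
      simp only [LinearMap.comp_apply, TensorProduct.map_tmul, LinearEquiv.coe_coe]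
      rw [hadamard_coassoc_left, H.comul_coassoc, K.comul_coassoc, ← hadamard_map_tensorComm,
        ← LinearMap.comp_apply, ← TensorProduct.map_comp]
      simp [TensorProduct.map_id]
  counit_comul I _ x := by
    induction x with
    | zero => simp
    | add x y hx hy => simp only [map_add, hx, hy]
    | tmul a b =>
      simp only [LinearMap.comp_apply, TensorProduct.map_tmul, LinearEquiv.coe_coe]
      rw [hadamard_lid, H.counit_comul, K.counit_comul]
  comul_counit I _ x := by
    induction x with
    | zero => simp
    | add x y hx hy => simp only [map_add, hx, hy]
    | tmul a b =>
      simp only [LinearMap.comp_apply, TensorProduct.map_tmul, LinearEquiv.coe_coe]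
      rw [hadamard_rid, H.comul_counit, K.comul_counit]
  comul_mul A B C D _ _ _ _ x y := by
    induction x with
    | zero => simp
    | add x y hx hy => simp only [TensorProduct.add_tmul, map_add, hx, hy]
    | tmul a b =>
      induction y with
      | zero => simp
      | add x y hx hy => simp only [TensorProduct.tmul_add, map_add, hx, hy]
      | tmul c d =>
        simp only [LinearMap.comp_apply, TensorProduct.map_tmul, LinearEquiv.coe_coe,
          TensorProduct.tensorTensorTensorComm_tmul]
        rw [H.comul_mul, K.comul_mul, hadamard_comul_mul]
  comul_one := by simp [H.comul_one, K.comul_one]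
  counit_mul x y := by
    induction x with
    | zero => simp
    | add x y hx hy => simp only [TensorProduct.add_tmul, map_add, hx, hy, add_mul]
    | tmul a b =>
      induction y with
      | zero => simp
      | add x y hx hy => simp only [TensorProduct.tmul_add, map_add, hx, hy, mul_add]
      | tmul c d => simp [H.counit_mul, K.counit_mul, mul_mul_mul_comm]
  counit_one := by simp [H.counit_one, K.counit_one]
  connected x := by
    induction x with
    | zero => simp
    | add x y hx hy => rw [map_add, add_smul, hx, hy]
    | tmul a b =>
      conv_rhs => rw [← H.connected a, ← K.connected b]
      simp [← TensorProduct.smul_tmul', smul_smul, mul_comm]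

end Hadamard

section LinearOrders

/-- The set of linear orders on `I`, given by their relations `≤`. -/
structure LinearOrdering (I : Type u) where
  le : I → I → Prop
  isLinearOrder : IsLinearOrder I le

namespace LinearOrdering

variable {I J K : Type u}

theorem ext_iff_le {v w : LinearOrdering I} : v = w ↔ ∀ i j, v.le i j ↔ w.le i j := by
  obtain ⟨v, _⟩ := v
  obtain ⟨w, _⟩ := w
  simp [funext_iff]

instance [Finite I] : Finite (LinearOrdering I) :=
  Finite.of_injective (fun w : LinearOrdering I => w.le) fun v w h => by
    rw [ext_iff_le]; intro i j; exact iff_of_eq (congrFun (congrFun h i) j)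

noncomputable instance [Fintype I] : Fintype (LinearOrdering I) := Fintype.ofFinite _

/-- The order induced on `I` by an order on `J` along an injection `I → J`. -/
def comap (f : I → J) (hf : Function.Injective f) (w : LinearOrdering J) : LinearOrdering I where
  le i j := w.le (f i) (f j)
  isLinearOrder := by
    have h := w.isLinearOrder
    exact hf.isLinearOrder_onFun (r := w.le)

/-- Relabelling along a bijection. -/
def relabel (σ : I ≃ J) (w : LinearOrdering I) : LinearOrdering J := w.comap σ.symm σ.symm.injective

/-- The restriction of an order on `I ⊔ J` to `I`. -/
def left (w : LinearOrdering (I ⊕ J)) : LinearOrdering I := w.comap Sum.inl Sum.inl_injective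

/-- The restriction of an order on `I ⊔ J` to `J`. -/
def right (w : LinearOrdering (I ⊕ J)) : LinearOrdering J := w.comap Sum.inr Sum.inr_injective

/-- `I` is an initial segment of the order `w` on `I ⊔ J`. -/
def LeftInitial (w : LinearOrdering (I ⊕ J)) : Prop := ∀ (i : I) (j : J), w.le (Sum.inl i) (Sum.inr j)

/-- The unique linear order on the empty set. -/
def empty : LinearOrdering PEmpty.{u + 1} where
  le _ _ := True
  isLinearOrder :=
    { refl := fun a => a.elim, trans := fun a => a.elim, antisymm := fun a => a.elim,
      total := fun a => a.elim }

theorem eq_empty (w : LinearOrdering PEmpty.{u + 1}) : w = empty := by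
  rw [ext_iff_le]; intro i; exact i.elim

/-- Concatenation of linear orders. -/
def concat (w : LinearOrdering I) (u : LinearOrdering J) : LinearOrdering (I ⊕ J) where
  le := Sum.Lex w.le u.le
  isLinearOrder := by
    have hw := w.isLinearOrder
    have hu := u.isLinearOrder
    exact
      { refl := by
          rintro (a | a)
          · exact Sum.Lex.inl (refl a)
          · exact Sum.Lex.inr (refl a)
        trans := by
          rintro (a | a) (b | b) (c | c) <;> simp only [Sum.lex_inl_inl, Sum.lex_inr_inr,
            Sum.lex_inr_inl, Sum.Lex.sep, imp_true_iff, false_imp_iff]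
          · exact fun h h' => _root_.trans h h'
          · exact fun h h' => _root_.trans h h'
        antisymm := by
          rintro (a | a) (b | b) <;> simp only [Sum.lex_inl_inl, Sum.lex_inr_inr,
            Sum.lex_inr_inl, Sum.Lex.sep, imp_true_iff, false_imp_iff]
          · exact fun h h' => congrArg _ (antisymm h h')
          · exact fun h h' => congrArg _ (antisymm h h')
        total := by
          rintro (a | a) (b | b) <;> simp only [Sum.lex_inl_inl, Sum.lex_inr_inr,
            Sum.lex_inr_inl, Sum.Lex.sep, true_or, or_true]
          · exact total_of _ a b
          · exact total_of _ a b }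

theorem concat_eq_iff (w : LinearOrdering I) (u : LinearOrdering J) (v : LinearOrdering (I ⊕ J)) :
    v = concat w u ↔ v.LeftInitial ∧ v.left = w ∧ v.right = u := by
  have hv := v.isLinearOrder
  constructor
  · rintro rfl
    refine ⟨fun i j => Sum.Lex.sep i j, ?_, ?_⟩ <;> rw [ext_iff_le] <;> intro i j <;>
      simp [left, right, comap, concat]
  · rintro ⟨h, rfl, rfl⟩
    rw [ext_iff_le]
    rintro (i | i) (j | j) <;> simp only [concat, left, right, comap, Sum.lex_inl_inl,
      Sum.lex_inr_inr, Sum.lex_inr_inl, Sum.Lex.sep, iff_true, iff_false]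
    · exact h i j
    · intro h'
      exact Sum.inl_ne_inr (antisymm (h j i) h')

end LinearOrdering

variable (k : Type v) [Field k]

/-- The vector space spanned by the linear orders on `I`. -/
abbrev LinOrdSpace (I : Type u) : Type (max u v) := LinearOrdering I →₀ k

namespace LinOrdSpace

open LinearOrdering Classical

variable {I J K I' J' : Type u} [Fintype I] [Fintype J] [Fintype K] [Fintype I'] [Fintype J']

/-- Relabelling, extended linearly. -/
noncomputable def map (σ : I ≃ J) : LinOrdSpace k I →ₗ[k] LinOrdSpace k J :=
  Finsupp.lmapDomain k k (LinearOrdering.relabel σ)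

/-- The shuffle product: `w ⊗ u` is sent to the sum of all orders on `I ⊔ J` that restrict to `w`
on `I` and to `u` on `J`. -/
noncomputable def mul (I J : Type u) [Fintype I] [Fintype J] :
    LinOrdSpace k I ⊗[k] LinOrdSpace k J →ₗ[k] LinOrdSpace k (I ⊕ J) :=
  TensorProduct.lift (Finsupp.lift _ k _ fun w : LinearOrdering I => Finsupp.lift _ k _ fun u : LinearOrdering J =>
    ∑ v : LinearOrdering (I ⊕ J) with v.left = w ∧ v.right = u, Finsupp.single v 1)

/-- The coproduct: `v` is sent to `v|I ⊗ v|J` if `I` is an initial segment of `v`, and to `0`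
otherwise. -/
noncomputable def comul (I J : Type u) [Fintype I] [Fintype J] :
    LinOrdSpace k (I ⊕ J) →ₗ[k] LinOrdSpace k I ⊗[k] LinOrdSpace k J :=
  Finsupp.lift _ k _ fun v : LinearOrdering (I ⊕ J) =>
    if v.LeftInitial then Finsupp.single v.left 1 ⊗ₜ[k] Finsupp.single v.right 1 else 0

/-- The counit, with value `1` on the empty order. -/
noncomputable def counit : LinOrdSpace k PEmpty.{u + 1} →ₗ[k] k :=
  Finsupp.lift _ k _ fun _ => 1

theorem map_single (σ : I ≃ J) (w : LinearOrdering I) (r : k) :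
    map k σ (Finsupp.single w r) = Finsupp.single (w.relabel σ) r := by
  simp [map]

theorem relabel_bijective (σ : I ≃ J) : Function.Bijective (LinearOrdering.relabel σ) := by
  refine Function.bijective_iff_has_inverse.2 ⟨LinearOrdering.relabel σ.symm, fun w => ?_, fun w => ?_⟩ <;>
  · rw [LinearOrdering.ext_iff_le]; intro i j; simp [LinearOrdering.relabel, LinearOrdering.comap]

theorem map_apply (σ : I ≃ J) (f : LinOrdSpace k I) (w : LinearOrdering J) :
    map k σ f w = f (w.relabel σ.symm) := by
  have h : w = (w.relabel σ.symm).relabel σ := by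
    rw [LinearOrdering.ext_iff_le]; intro i j; simp [LinearOrdering.relabel, LinearOrdering.comap]
  conv_lhs => rw [h]
  exact Finsupp.mapDomain_apply (relabel_bijective σ).1 _ _

theorem mul_apply (f : LinOrdSpace k I) (g : LinOrdSpace k J) (v : LinearOrdering (I ⊕ J)) :
    mul k I J (f ⊗ₜ g) v = f v.left * g v.right := by
  induction f using Finsupp.induction_linear with
  | zero => simp
  | add f f' h h' => simp only [TensorProduct.add_tmul, map_add, Finsupp.add_apply, h, h', add_mul]
  | single w r =>
    induction g using Finsupp.induction_linear with
    | zero => simp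
    | add f f' h h' =>
      simp only [TensorProduct.tmul_add, map_add, Finsupp.add_apply, h, h', mul_add]
    | single u s =>
      simp only [mul, TensorProduct.lift.tmul, Finsupp.lift_apply, Finsupp.sum_single_index,
        zero_smul, LinearMap.smul_apply, Finsupp.smul_apply, Finsupp.finsetSum_apply,
        Finsupp.single_apply, Finset.sum_ite_eq', Finset.mem_filter, Finset.mem_univ, true_and,
        eq_comm (a := w), eq_comm (a := u), smul_eq_mul]
      split_ifs <;> simp_all

theorem comul_single (v : LinearOrdering (I ⊕ J)) (r : k) :
    comul k I J (Finsupp.single v r) =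
      if v.LeftInitial then r • (Finsupp.single v.left 1 ⊗ₜ[k] Finsupp.single v.right 1) else 0 := by
  simp only [comul, Finsupp.lift_apply, zero_smul, Finsupp.sum_single_index]
  split_ifs <;> simp

/-- The coefficient of `w ⊗ u` in the coproduct of `f`. -/
theorem comul_coeff (f : LinOrdSpace k (I ⊕ J)) (w : LinearOrdering I) (u : LinearOrdering J) :
    finsuppTensorFinsupp' k (LinearOrdering I) (LinearOrdering J) (comul k I J f) (w, u) = f (w.concat u) := by
  induction f using Finsupp.induction_linear with
  | zero => simp
  | add f f' h h' => simp only [map_add, Finsupp.add_apply, h, h']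
  | single v r =>
    rw [comul_single, Finsupp.single_apply, LinearOrdering.concat_eq_iff]
    by_cases h : v.LeftInitial <;>
      simp [h, Finsupp.single_apply, finsuppTensorFinsupp'_single_tmul_single]

theorem mul_mul_coeff {A B C D : Type u} [Fintype A] [Fintype B] [Fintype C] [Fintype D]
    (a : LinOrdSpace k A ⊗[k] LinOrdSpace k B) (b : LinOrdSpace k C ⊗[k] LinOrdSpace k D)
    (v : LinearOrdering (A ⊕ C)) (v' : LinearOrdering (B ⊕ D)) :
    finsuppTensorFinsupp' k _ _ (TensorProduct.map (mul k A C) (mul k B D)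
      (TensorProduct.tensorTensorTensorComm k _ _ _ _ (a ⊗ₜ b))) (v, v') =
    finsuppTensorFinsupp' k _ _ a (v.left, v'.left) *
      finsuppTensorFinsupp' k _ _ b (v.right, v'.right) := by
  induction a with
  | zero => simp
  | add x y hx hy => simp only [TensorProduct.add_tmul, map_add, Finsupp.add_apply, hx, hy, add_mul]
  | tmul a₀ b₀ =>
    induction b with
    | zero => simp
    | add x y hx hy =>
      simp only [TensorProduct.tmul_add, map_add, Finsupp.add_apply, hx, hy, mul_add]
    | tmul a₁ b₁ => simp [mul_apply, finsuppTensorFinsupp'_apply_apply, mul_mul_mul_comm]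

end LinOrdSpace

open LinearOrdering LinOrdSpace Classical in
/-- The Hopf monoid `L*` of linear orders. -/
@[reducible] noncomputable def LStar : ConnectedHopfMonoid.{u, v, max u v} k where
  obj I _ := LinOrdSpace k I
  map σ := LinOrdSpace.map k σ
  mul I J _ _ := LinOrdSpace.mul k I J
  one := Finsupp.single LinearOrdering.empty 1
  comul I J _ _ := LinOrdSpace.comul k I J
  counit := LinOrdSpace.counit k
  map_refl I _ x := by
    ext w; rw [LinOrdSpace.map_apply]; rfl
  map_trans σ τ x := by
    ext w; simp only [LinOrdSpace.map_apply]; rfl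
  mul_natural σ τ x y := by
    ext w; simp only [LinOrdSpace.map_apply, LinOrdSpace.mul_apply]; rfl
  comul_natural σ τ x := by
    induction x using Finsupp.induction_linear with
    | zero => simp
    | add x y hx hy => simp only [map_add, hx, hy]
    | single w r =>
      have h : (w.relabel (Equiv.sumCongr σ τ)).LeftInitial ↔ w.LeftInitial := by
        simp [LeftInitial, relabel, comap, σ.symm.surjective.forall, τ.symm.surjective.forall]
      rw [LinOrdSpace.map_single, comul_single, comul_single]
      by_cases h' : w.LeftInitial
      · rw [if_pos h', if_pos (h.2 h')]
        simp only [_root_.map_smul, TensorProduct.map_tmul, LinOrdSpace.map_single]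
        rfl
      · rw [if_neg h', if_neg (mt h.1 h'), map_zero]
  mul_assoc I J K _ _ _ x y z := by
    ext w; simp only [LinOrdSpace.map_apply, LinOrdSpace.mul_apply, _root_.mul_assoc]; rfl
  one_mul I _ x := by
    ext w; simp only [LinOrdSpace.map_apply, LinOrdSpace.mul_apply]
    rw [eq_empty (left _), Finsupp.single_eq_same, _root_.one_mul]; rfl
  mul_one I _ x := by
    ext w; simp only [LinOrdSpace.map_apply, LinOrdSpace.mul_apply]
    rw [eq_empty (right _), Finsupp.single_eq_same, _root_.mul_one]; rfl
  comul_coassoc I J K _ _ _ x := by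
    induction x using Finsupp.induction_linear with
    | zero => simp
    | add x y hx hy => simp only [map_add, hx, hy]
    | single w r =>
      have hw := w.isLinearOrder
      rw [LinOrdSpace.map_single, comul_single, comul_single]
      have h : (w.LeftInitial ∧ w.left.LeftInitial) ↔
          ((w.relabel (Equiv.sumAssoc I J K)).LeftInitial ∧
            (w.relabel (Equiv.sumAssoc I J K)).right.LeftInitial) := by
        simp only [LeftInitial, relabel, comap, left, right, Sum.forall, Equiv.sumAssoc_symm_apply_inl,
          Equiv.sumAssoc_symm_apply_inr_inl, Equiv.sumAssoc_symm_apply_inr_inr]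
        grind
      by_cases h₁ : w.LeftInitial ∧ w.left.LeftInitial
      · rw [if_pos h₁.1, if_pos (h.1 h₁).1]
        simp only [_root_.map_smul, TensorProduct.map_tmul, comul_single, if_pos h₁.2,
          if_pos (h.1 h₁).2, one_smul, LinearMap.id_apply, TensorProduct.assoc_tmul]
        rfl
      · have h₂ := mt h.2 h₁
        have e₁ : TensorProduct.map (LinOrdSpace.comul k I J) LinearMap.id
            (if w.LeftInitial then r • (Finsupp.single w.left 1 ⊗ₜ[k] Finsupp.single w.right 1)
              else (0 : LinOrdSpace k (I ⊕ J) ⊗[k] LinOrdSpace k K)) = 0 := by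
          by_cases h₃ : w.LeftInitial
          · simp [if_pos h₃, comul_single, show ¬ w.left.LeftInitial from fun h => h₁ ⟨h₃, h⟩]
          · simp [h₃]
        have e₂ (w' : LinearOrdering (I ⊕ (J ⊕ K))) (h : ¬ (w'.LeftInitial ∧ w'.right.LeftInitial)) :
            TensorProduct.map LinearMap.id (LinOrdSpace.comul k J K)
            (if w'.LeftInitial then r • (Finsupp.single w'.left 1 ⊗ₜ[k] Finsupp.single w'.right 1)
              else (0 : LinOrdSpace k I ⊗[k] LinOrdSpace k (J ⊕ K))) = 0 := by
          by_cases h₃ : w'.LeftInitial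
          · simp [if_pos h₃, comul_single, show ¬ w'.right.LeftInitial from fun h' => h ⟨h₃, h'⟩]
          · simp [h₃]
        rw [e₁, e₂ _ h₂, map_zero]
  counit_comul I _ x := by
    induction x using Finsupp.induction_linear with
    | zero => simp
    | add x y hx hy => simp only [map_add, hx, hy]
    | single w r =>
      have h : w.LeftInitial := fun i => i.elim
      rw [comul_single, if_pos h, LinOrdSpace.map_single]
      simp only [_root_.map_smul, TensorProduct.map_tmul, LinOrdSpace.counit, Finsupp.lift_apply,
        Finsupp.sum_single_index, zero_smul, TensorProduct.lid_tmul, LinearMap.id_apply,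
        Finsupp.smul_single, smul_eq_mul, _root_.mul_one]
      rfl
  comul_counit I _ x := by
    induction x using Finsupp.induction_linear with
    | zero => simp
    | add x y hx hy => simp only [map_add, hx, hy]
    | single w r =>
      have h : w.LeftInitial := fun _ i => i.elim
      rw [comul_single, if_pos h, LinOrdSpace.map_single]
      simp only [_root_.map_smul, TensorProduct.map_tmul, LinOrdSpace.counit, Finsupp.lift_apply,
        Finsupp.sum_single_index, zero_smul, TensorProduct.rid_tmul, LinearMap.id_apply,
        Finsupp.smul_single, smul_eq_mul, _root_.mul_one]
      rfl
  comul_mul A B C D _ _ _ _ x y := by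
    apply (finsuppTensorFinsupp' k _ _).injective
    ext ⟨v, v'⟩
    rw [mul_mul_coeff, comul_coeff, LinOrdSpace.map_apply, LinOrdSpace.mul_apply, comul_coeff,
      comul_coeff]
    congr 2 <;> rw [ext_iff_le] <;> rintro (i | i) (j | j) <;>
      simp [left, right, relabel, comap, concat]
  comul_one := by
    have h (w : LinearOrdering (PEmpty.{u + 1} ⊕ PEmpty.{u + 1})) : w.LeftInitial :=
      fun i => i.elim
    rw [LinOrdSpace.map_single, comul_single, if_pos (h _), one_smul,
      eq_empty (left _), eq_empty (right _)]
  counit_mul x y := by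
    have h (f : LinOrdSpace k PEmpty.{u + 1}) : LinOrdSpace.counit k f = f LinearOrdering.empty := by
      induction f using Finsupp.induction_linear with
      | zero => simp
      | add x y hx hy => simp only [map_add, hx, hy, Finsupp.add_apply]
      | single w r => simp [LinOrdSpace.counit, eq_empty w]
    simp only [h, LinOrdSpace.map_apply, LinOrdSpace.mul_apply, eq_empty (left _),
      eq_empty (right _)]
  counit_one := by simp [LinOrdSpace.counit]
  connected x := by
    induction x using Finsupp.induction_linear with
    | zero => simp
    | add x y hx hy => rw [map_add, add_smul, hx, hy]
    | single w r => simp [LinOrdSpace.counit, eq_empty w]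

end LinearOrders

section GeneralizedPermutahedra

/-- The face `p_x` of `p` on which the functional `y ↦ x ⬝ y` is maximized. -/
def maxFace {I : Type u} [Fintype I] (p : Set (I → ℝ)) (x : I → ℝ) : Set (I → ℝ) :=
  {y | y ∈ p ∧ ∀ z ∈ p, x ⬝ᵥ z ≤ x ⬝ᵥ y}

/-- The (relatively open) normal cone of a face `q` of `p`. -/
def normalCone {I : Type u} [Fintype I] (p q : Set (I → ℝ)) : Set (I → ℝ) :=
  {x | maxFace p x = q}

/-- The normal fan of `p`: the set of normal cones of its faces. -/
def normalFan {I : Type u} [Fintype I] (p : Set (I → ℝ)) : Set (Set (I → ℝ)) :=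
  Set.range fun x => normalCone p (maxFace p x)

/-- The (relatively open) face of the braid arrangement that contains `x`. -/
def braidFace {I : Type u} (x : I → ℝ) : Set (I → ℝ) :=
  {y | ∀ i j, y i < y j ↔ x i < x j}

/-- The braid fan in `ℝ^I`. -/
def braidFan (I : Type u) : Set (Set (I → ℝ)) := Set.range braidFace

/-- `p` is a (nonempty) polytope: the convex hull of a nonempty finite set. -/
def IsPolytope {I : Type u} (p : Set (I → ℝ)) : Prop :=
  ∃ V : Set (I → ℝ), V.Finite ∧ V.Nonempty ∧ p = convexHull ℝ V

/-- A generalized permutahedron in `ℝ^I`: a polytope whose normal fan coarsens the braid fan. -/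
structure GenPerm (I : Type u) [Fintype I] where
  carrier : Set (I → ℝ)
  isPolytope : IsPolytope carrier
  coarsens : ∀ σ ∈ braidFan I, ∃ τ ∈ normalFan carrier, σ ⊆ τ

variable {I J K : Type u} [Fintype I] [Fintype J] [Fintype K]

/-- The product of `A ⊆ ℝ^I` and `B ⊆ ℝ^J`, as a subset of `ℝ^(I ⊔ J)`. -/
def prodSet {I J : Type u} (A : Set (I → ℝ)) (B : Set (J → ℝ)) : Set (I ⊕ J → ℝ) :=
  {z | z ∘ Sum.inl ∈ A ∧ z ∘ Sum.inr ∈ B}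

/-- The image of `A ⊆ ℝ^I` under the isomorphism `ℝ^I ≃ ℝ^J` that relabels coordinates by `σ`. -/
def relabelSet {I J : Type u} (σ : I ≃ J) (A : Set (I → ℝ)) : Set (J → ℝ) := {z | z ∘ σ ∈ A}

/-- The projection of a subset of `ℝ^(I ⊔ J)` to `ℝ^I`. -/
def projLeft {I J : Type u} (A : Set (I ⊕ J → ℝ)) : Set (I → ℝ) := (fun z => z ∘ Sum.inl) '' A

/-- The projection of a subset of `ℝ^(I ⊔ J)` to `ℝ^J`. -/
def projRight {I J : Type u} (A : Set (I ⊕ J → ℝ)) : Set (J → ℝ) := (fun z => z ∘ Sum.inr) '' A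

theorem comp_symm_mem_relabelSet {I J : Type u} (σ : I ≃ J) {A : Set (I → ℝ)} {y : I → ℝ}
    (hy : y ∈ A) : y ∘ σ.symm ∈ relabelSet σ A := by
  simpa [relabelSet, Function.comp_assoc] using hy

theorem dot_sum (x z : I ⊕ J → ℝ) :
    x ⬝ᵥ z = (x ∘ Sum.inl) ⬝ᵥ (z ∘ Sum.inl) + (x ∘ Sum.inr) ⬝ᵥ (z ∘ Sum.inr) := by
  simp [dotProduct, Fintype.sum_sum_type]

theorem dot_relabel (σ : I ≃ J) (x z : J → ℝ) : (x ∘ σ) ⬝ᵥ (z ∘ σ) = x ⬝ᵥ z := by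
  simp [dotProduct, Equiv.sum_comp σ fun j => x j * z j]

theorem maxFace_zero (p : Set (I → ℝ)) : maxFace p 0 = p := by
  ext y; simp [maxFace]

theorem maxFace_relabel (σ : I ≃ J) (p : Set (I → ℝ)) (x : J → ℝ) :
    maxFace (relabelSet σ p) x = relabelSet σ (maxFace p (x ∘ σ)) := by
  ext y
  simp only [maxFace, relabelSet, Set.mem_ofPred_eq, and_congr_right_iff]
  intro _
  constructor
  · intro h z hz
    have := h (z ∘ σ.symm) (by simpa [Function.comp_assoc] using hz)
    rw [dot_relabel, ← dot_relabel σ] at *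
    simpa [Function.comp_assoc, dot_relabel] using this
  · intro h z hz
    simpa [dot_relabel] using h _ hz

theorem maxFace_prod (A : Set (I → ℝ)) (B : Set (J → ℝ)) (x : I ⊕ J → ℝ) :
    maxFace (prodSet A B) x =
      prodSet (maxFace A (x ∘ Sum.inl)) (maxFace B (x ∘ Sum.inr)) := by
  ext y
  simp only [maxFace, prodSet, Set.mem_ofPred_eq, dot_sum]
  constructor
  · rintro ⟨⟨h₁, h₂⟩, h⟩
    refine ⟨⟨h₁, fun a ha => ?_⟩, ⟨h₂, fun b hb => ?_⟩⟩
    · have := h (Sum.elim a (y ∘ Sum.inr)) (by simpa using ⟨ha, h₂⟩)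
      simpa using this
    · have := h (Sum.elim (y ∘ Sum.inl) b) (by simpa using ⟨h₁, hb⟩)
      simpa using this
  · rintro ⟨⟨h₁, h₂⟩, h₃, h₄⟩
    exact ⟨⟨h₁, h₃⟩, fun z hz => add_le_add (h₂ _ hz.1) (h₄ _ hz.2)⟩

theorem maxFace_projLeft (A : Set (I ⊕ J → ℝ)) (x : I → ℝ) :
    maxFace (projLeft A) x = projLeft (maxFace A (Sum.elim x 0)) := by
  ext y
  simp only [maxFace, projLeft, Set.mem_ofPred_eq, Set.mem_image, dot_sum]
  simp
  constructor
  · rintro ⟨⟨z, hz, rfl⟩, h⟩; exact ⟨z, ⟨hz, h⟩, rfl⟩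
  · rintro ⟨z, ⟨hz, h⟩, rfl⟩; exact ⟨⟨z, hz, rfl⟩, h⟩

theorem maxFace_projRight (A : Set (I ⊕ J → ℝ)) (y : J → ℝ) :
    maxFace (projRight A) y = projRight (maxFace A (Sum.elim 0 y)) := by
  ext y
  simp only [maxFace, projRight, Set.mem_ofPred_eq, Set.mem_image, dot_sum]
  simp
  constructor
  · rintro ⟨⟨z, hz, rfl⟩, h⟩; exact ⟨z, ⟨hz, h⟩, rfl⟩
  · rintro ⟨z, ⟨hz, h⟩, rfl⟩; exact ⟨⟨z, hz, rfl⟩, h⟩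

theorem projLeft_prodSet {I J : Type u} {A : Set (I → ℝ)} {B : Set (J → ℝ)} (hB : B.Nonempty) :
    projLeft (prodSet A B) = A := by
  obtain ⟨b, hb⟩ := hB
  ext a
  constructor
  · rintro ⟨z, hz, rfl⟩; exact hz.1
  · intro ha; exact ⟨Sum.elim a b, ⟨by simpa using ha, by simpa using hb⟩, by simp⟩

theorem projRight_prodSet {I J : Type u} {A : Set (I → ℝ)} {B : Set (J → ℝ)} (hA : A.Nonempty) :
    projRight (prodSet A B) = B := by
  obtain ⟨a, ha⟩ := hA
  ext b
  constructor
  · rintro ⟨z, hz, rfl⟩; exact hz.2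
  · intro hb; exact ⟨Sum.elim a b, ⟨by simpa using ha, by simpa using hb⟩, by simp⟩

section Polytope

theorem IsPolytope.isCompact {p : Set (I → ℝ)} (h : IsPolytope p) : IsCompact p := by
  obtain ⟨V, hV, -, rfl⟩ := h
  exact hV.isCompact_convexHull ℝ

theorem IsPolytope.convex {I : Type u} {p : Set (I → ℝ)} (h : IsPolytope p) : Convex ℝ p := by
  obtain ⟨V, -, -, rfl⟩ := h
  exact convex_convexHull ℝ V

theorem IsPolytope.nonempty {I : Type u} {p : Set (I → ℝ)} (h : IsPolytope p) : p.Nonempty := by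
  obtain ⟨V, -, hV, rfl⟩ := h
  exact hV.mono (subset_convexHull ℝ V)

theorem IsPolytope.image {I J : Type u} {p : Set (I → ℝ)} (h : IsPolytope p)
    (f : (I → ℝ) →ₗ[ℝ] (J → ℝ)) : IsPolytope (f '' p) := by
  obtain ⟨V, hV, hV', rfl⟩ := h
  exact ⟨f '' V, hV.image f, hV'.image f, f.image_convexHull V⟩

theorem IsPolytope.relabel {I J : Type u} {p : Set (I → ℝ)} (h : IsPolytope p) (σ : I ≃ J) :
    IsPolytope (relabelSet σ p) := by
  convert h.image (LinearMap.funLeft ℝ ℝ σ.symm) using 1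
  ext z
  constructor
  · intro hz
    exact ⟨_, hz, by ext; simp [LinearMap.funLeft]⟩
  · rintro ⟨y, hy, rfl⟩
    simpa [relabelSet, LinearMap.funLeft, Function.comp_assoc] using hy

theorem IsPolytope.prod {I J : Type u} {p : Set (I → ℝ)} {q : Set (J → ℝ)} (hp : IsPolytope p)
    (hq : IsPolytope q) : IsPolytope (prodSet p q) := by
  obtain ⟨V, hV, hV', rfl⟩ := hp
  obtain ⟨W, hW, hW', rfl⟩ := hq
  refine ⟨(LinearEquiv.sumArrowLequivProdArrow I J ℝ ℝ).symm.toLinearMap '' (V ×ˢ W),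
    (hV.prod hW).image _, (hV'.prod hW').image _, ?_⟩
  rw [← LinearMap.image_convexHull, convexHull_prod]
  ext z
  constructor
  · intro hz
    exact ⟨(z ∘ Sum.inl, z ∘ Sum.inr), hz, by ext (i | i) <;> rfl⟩
  · rintro ⟨⟨a, b⟩, hab, rfl⟩
    exact hab

theorem maxFace_isExposed (p : Set (I → ℝ)) (x : I → ℝ) : IsExposed ℝ p (maxFace p x) := by
  intro _
  refine ⟨LinearMap.toContinuousLinearMap (dotProductBilin ℝ ℝ x), ?_⟩
  rfl

theorem IsPolytope.maxFace_nonempty {p : Set (I → ℝ)} (h : IsPolytope p) (x : I → ℝ) :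
    (maxFace p x).Nonempty := by
  have hc : Continuous fun y : I → ℝ => x ⬝ᵥ y := by unfold dotProduct; fun_prop
  obtain ⟨y, hy, hm⟩ := h.isCompact.exists_isMaxOn h.nonempty hc.continuousOn
  exact ⟨y, hy, fun z hz => hm hz⟩

theorem IsPolytope.maxFace {p : Set (I → ℝ)} (h : IsPolytope p) (x : I → ℝ) :
    IsPolytope (maxFace p x) := by
  have he := maxFace_isExposed p x
  have hn := h.maxFace_nonempty x
  have hc := he.isCompact h.isCompact
  have hx := he.convex h.convex
  obtain ⟨V, hV, hV', rfl⟩ := h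
  have hsub : (_root_.maxFace (convexHull ℝ V) x).extremePoints ℝ ⊆ V :=
    (he.isExtreme.extremePoints_subset_extremePoints).trans extremePoints_convexHull_subset
  have hfin := hV.subset hsub
  refine ⟨_, hfin, hc.extremePoints_nonempty hn, ?_⟩
  rw [← (hfin.isClosed_convexHull ℝ).closure_eq]
  exact (closure_convexHull_extremePoints hc hx).symm

/-- A point on which no functional exceeds its maximum on the compact convex set `q` lies in `q`. -/
theorem IsPolytope.mem_of_forall {q : Set (I → ℝ)} (h : IsPolytope q) (z : I → ℝ)
    (hz : ∀ x : I → ℝ, ∃ y ∈ q, x ⬝ᵥ z ≤ x ⬝ᵥ y) : z ∈ q := by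
  classical
  by_contra hzq
  obtain ⟨f, s, hf, hs⟩ := geometric_hahn_banach_closed_point h.convex h.isCompact.isClosed hzq
  have hdot (y : I → ℝ) : f y = (fun i => f (fun j => if i = j then 1 else 0)) ⬝ᵥ y := by
    have := LinearMap.pi_apply_eq_sum_univ f.toLinearMap y
    simp only [ContinuousLinearMap.coe_coe, smul_eq_mul] at this
    rw [this, dotProduct]
    refine Finset.sum_congr rfl fun i _ => ?_
    rw [mul_comm]
  obtain ⟨y, hy, hle⟩ := hz (fun i => f (fun j => if i = j then 1 else 0))
  rw [← hdot, ← hdot] at hle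
  exact absurd (hf y hy) (by linarith)

end Polytope

theorem coarsens_iff (p : Set (I → ℝ)) :
    (∀ σ ∈ braidFan I, ∃ τ ∈ normalFan p, σ ⊆ τ) ↔
      ∀ x y : I → ℝ, (∀ i j, y i < y j ↔ x i < x j) → maxFace p y = maxFace p x := by
  constructor
  · intro h x y hxy
    obtain ⟨_, ⟨u, rfl⟩, hu⟩ := h _ ⟨x, rfl⟩
    have h₁ : maxFace p y = maxFace p u := hu hxy
    have h₂ : maxFace p x = maxFace p u := hu fun _ _ => Iff.rfl
    rw [h₁, h₂]
  · rintro h _ ⟨x, rfl⟩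
    exact ⟨_, ⟨x, rfl⟩, fun y hy => h x y hy⟩

/-- If the faces in the directions `u + ε v` agree for all small `ε > 0`, they agree with the
`v`-maximal face of the `u`-maximal face. -/
theorem maxFace_maxFace (p F : Set (I → ℝ)) (u v : I → ℝ) (ε₀ : ℝ) (hε₀ : 0 < ε₀)
    (hF : F.Nonempty) (h : ∀ ε, 0 < ε → ε < ε₀ → maxFace p (u + ε • v) = F) :
    maxFace (maxFace p u) v = F := by
  have key : F ⊆ maxFace (maxFace p u) v := by
    intro z hz
    have hzp : z ∈ p := by
      rw [← h (ε₀ / 2) (by linarith) (by linarith)] at hz; exact hz.1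
    have hle : ∀ w ∈ p, ∀ ε, 0 < ε → ε < ε₀ →
        u ⬝ᵥ w + ε * (v ⬝ᵥ w) ≤ u ⬝ᵥ z + ε * (v ⬝ᵥ z) := by
      intro w hw ε h₁ h₂
      have hz' := hz
      rw [← h ε h₁ h₂] at hz'
      simpa [add_dotProduct, smul_dotProduct] using hz'.2 w hw
    have hu : ∀ w ∈ p, u ⬝ᵥ w ≤ u ⬝ᵥ z := by
      intro w hw
      by_contra! hlt
      set D := v ⬝ᵥ z - v ⬝ᵥ w with hD
      set E := u ⬝ᵥ w - u ⬝ᵥ z with hE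
      have hEpos : 0 < E := by linarith
      have h1 : 0 < min (ε₀ / 2) (E / (2 * (|D| + 1))) := by positivity
      have h2 := hle w hw _ h1 (lt_of_le_of_lt (min_le_left _ _) (by linarith))
      set ε := min (ε₀ / 2) (E / (2 * (|D| + 1)))
      have h3 : ε ≤ E / (2 * (|D| + 1)) := min_le_right _ _
      rw [le_div_iff₀ (by positivity)] at h3
      have h4 : ε * D ≤ ε * |D| := mul_le_mul_of_nonneg_left (le_abs_self D) h1.le
      nlinarith
    refine ⟨⟨hzp, hu⟩, fun w hw => ?_⟩
    have h1 := hle w hw.1 (ε₀ / 2) (by linarith) (by linarith)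
    have h2 := hw.2 z hzp
    nlinarith
  refine Set.Subset.antisymm (fun y hy => ?_) key
  obtain ⟨z, hz⟩ := hF
  have hz' := key hz
  have e1 : u ⬝ᵥ y = u ⬝ᵥ z := le_antisymm (hz'.1.2 y hy.1.1) (hy.1.2 z hz'.1.1)
  have e2 : v ⬝ᵥ y = v ⬝ᵥ z := le_antisymm (hz'.2 y hy.1) (hy.2 z hz'.1)
  have hF' := h (ε₀ / 2) (by linarith) (by linarith)
  rw [← hF'] at hz ⊢
  refine ⟨hy.1.1, fun w hw => ?_⟩
  have := hz.2 w hw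
  simp only [add_dotProduct, smul_dotProduct, e1, e2] at *
  exact this

namespace GenPerm

theorem ext_carrier {p q : GenPerm I} (h : p.carrier = q.carrier) : p = q := by
  obtain ⟨_, _, _⟩ := p
  obtain ⟨_, _, _⟩ := q
  simp only at h
  subst h
  rfl

theorem maxFace_eq (p : GenPerm I) (x y : I → ℝ) (h : ∀ i j, y i < y j ↔ x i < x j) :
    maxFace p.carrier y = maxFace p.carrier x :=
  (coarsens_iff _).1 p.coarsens x y h

/-- The face of `p` that is maximal in the direction of the indicator vector of `I`. -/
def splitFace (p : GenPerm (I ⊕ J)) : Set (I ⊕ J → ℝ) :=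
  maxFace p.carrier (Sum.elim (fun _ => 1) (fun _ => 0))

theorem splitFace_isPolytope (p : GenPerm (I ⊕ J)) : IsPolytope p.splitFace :=
  p.isPolytope.maxFace _

theorem maxFace_splitFace (p : GenPerm (I ⊕ J)) (x x' : I ⊕ J → ℝ)
    (hl : ∀ i j : I, x' (Sum.inl i) < x' (Sum.inl j) ↔ x (Sum.inl i) < x (Sum.inl j))
    (hr : ∀ i j : J, x' (Sum.inr i) < x' (Sum.inr j) ↔ x (Sum.inr i) < x (Sum.inr j)) :
    maxFace p.splitFace x' = maxFace p.splitFace x := by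
  set o : I ⊕ J → ℝ := Sum.elim (fun _ => 1) (fun _ => 0) with ho
  have hb (y : I ⊕ J → ℝ) (i) : |y i| ≤ ∑ j, |y j| :=
    Finset.single_le_sum (f := fun j => |y j|) (fun _ _ => abs_nonneg _) (Finset.mem_univ i)
  obtain ⟨M, hM, hM₁, hM₂⟩ : ∃ M : ℝ, 0 < M ∧ (∀ i, |x i| ≤ M) ∧ ∀ i, |x' i| ≤ M := by
    have h1 : 0 ≤ ∑ j, |x j| := by positivity
    have h2 : 0 ≤ ∑ j, |x' j| := by positivity
    refine ⟨∑ j, |x j| + ∑ j, |x' j| + 1, by positivity, fun i => ?_, fun i => ?_⟩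
    · linarith [hb x i]
    · linarith [hb x' i]
  have hsmall (y : I ⊕ J → ℝ) (hy : ∀ i, |y i| ≤ M) (ε : ℝ) (h₀ : 0 < ε) (h₁ : ε < 1 / (2 * M))
      (i : I ⊕ J) : |ε * y i| < 1 / 2 := by
    rw [lt_div_iff₀ (by positivity)] at h₁
    rw [abs_mul, abs_of_pos h₀]
    nlinarith [mul_le_mul_of_nonneg_left (hy i) h₀.le]
  have hsame (y y' : I ⊕ J → ℝ) (hy : ∀ i, |y i| ≤ M) (hy' : ∀ i, |y' i| ≤ M)
      (hl : ∀ i j : I, y' (Sum.inl i) < y' (Sum.inl j) ↔ y (Sum.inl i) < y (Sum.inl j))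
      (hr : ∀ i j : J, y' (Sum.inr i) < y' (Sum.inr j) ↔ y (Sum.inr i) < y (Sum.inr j))
      (ε ε' : ℝ) (h₀ : 0 < ε) (h₁ : ε < 1 / (2 * M)) (h₀' : 0 < ε') (h₁' : ε' < 1 / (2 * M)) :
      maxFace p.carrier (o + ε' • y') = maxFace p.carrier (o + ε • y) := by
    apply p.maxFace_eq
    rintro (i | i) (j | j)
    · simp [ho, h₀, h₀', hl]
    · have a1 := abs_lt.1 (hsmall y hy ε h₀ h₁ (Sum.inl i))
      have a2 := abs_lt.1 (hsmall y hy ε h₀ h₁ (Sum.inr j))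
      have a3 := abs_lt.1 (hsmall y' hy' ε' h₀' h₁' (Sum.inl i))
      have a4 := abs_lt.1 (hsmall y' hy' ε' h₀' h₁' (Sum.inr j))
      simp only [ho, Pi.add_apply, Sum.elim_inl, Sum.elim_inr, Pi.smul_apply, smul_eq_mul]
      constructor <;> intro <;> linarith
    · have a1 := abs_lt.1 (hsmall y hy ε h₀ h₁ (Sum.inr i))
      have a2 := abs_lt.1 (hsmall y hy ε h₀ h₁ (Sum.inl j))
      have a3 := abs_lt.1 (hsmall y' hy' ε' h₀' h₁' (Sum.inr i))
      have a4 := abs_lt.1 (hsmall y' hy' ε' h₀' h₁' (Sum.inl j))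
      simp only [ho, Pi.add_apply, Sum.elim_inl, Sum.elim_inr, Pi.smul_apply, smul_eq_mul]
      constructor <;> intro <;> linarith
    · simp [ho, h₀, h₀', hr]
  have hpos : 0 < 1 / (2 * M) := by positivity
  have hh0 : 0 < 1 / (2 * M) / 2 := by positivity
  have hh1 : 1 / (2 * M) / 2 < 1 / (2 * M) := by linarith
  have hne := p.isPolytope.maxFace_nonempty (o + (1 / (2 * M) / 2) • x)
  rw [splitFace, maxFace_maxFace p.carrier _ o x' _ hpos hne fun ε h₀ h₁ =>
      hsame x x' hM₁ hM₂ hl hr _ ε hh0 hh1 h₀ h₁,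
    maxFace_maxFace p.carrier _ o x _ hpos hne fun ε h₀ h₁ =>
      hsame x x hM₁ hM₁ (fun _ _ => Iff.rfl) (fun _ _ => Iff.rfl) _ ε hh0 hh1 h₀ h₁]

/-- The restriction `p|I`: the projection to `ℝ^I` of the face of `p` that is maximal in the
direction of the indicator vector of `I` (this face is the product of `p|I` and `p/I`, see
`splitFace_eq`). -/
def restrict (p : GenPerm (I ⊕ J)) : GenPerm I where
  carrier := projLeft p.splitFace
  isPolytope := p.splitFace_isPolytope.image (LinearMap.funLeft ℝ ℝ Sum.inl)
  coarsens := by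
    rw [coarsens_iff]
    intro x y h
    rw [maxFace_projLeft, maxFace_projLeft,
      p.maxFace_splitFace (Sum.elim x 0) (Sum.elim y 0) (by simpa using h) (by simp)]

/-- The contraction `p/I`: the projection to `ℝ^J` of the face of `p` that is maximal in the
direction of the indicator vector of `I`. -/
def contract (p : GenPerm (I ⊕ J)) : GenPerm J where
  carrier := projRight p.splitFace
  isPolytope := p.splitFace_isPolytope.image (LinearMap.funLeft ℝ ℝ Sum.inr)
  coarsens := by
    rw [coarsens_iff]
    intro x y h
    rw [maxFace_projRight, maxFace_projRight,
      p.maxFace_splitFace (Sum.elim 0 x) (Sum.elim 0 y) (by simp) (by simpa using h)]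

/-- The face of `p` in the direction of the indicator vector of `I` is `p|I × p/I`. -/
theorem splitFace_eq (p : GenPerm (I ⊕ J)) :
    p.splitFace = prodSet p.restrict.carrier p.contract.carrier := by
  refine Set.Subset.antisymm (fun z hz => ⟨⟨z, hz, rfl⟩, ⟨z, hz, rfl⟩⟩) fun z hz => ?_
  obtain ⟨⟨a, ha, hza⟩, ⟨b, hb, hzb⟩⟩ := hz
  refine p.splitFace_isPolytope.mem_of_forall z fun x => ?_
  obtain ⟨y, hy⟩ := p.splitFace_isPolytope.maxFace_nonempty x
  refine ⟨y, hy.1, ?_⟩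
  have hscale (s t : ℝ) (hs : 0 < s) (ht : 0 < t) (w : I ⊕ J → ℝ) (hw : w ∈ p.splitFace) :
      s * ((x ∘ Sum.inl) ⬝ᵥ (w ∘ Sum.inl)) + t * ((x ∘ Sum.inr) ⬝ᵥ (w ∘ Sum.inr)) ≤
        s * ((x ∘ Sum.inl) ⬝ᵥ (y ∘ Sum.inl)) + t * ((x ∘ Sum.inr) ⬝ᵥ (y ∘ Sum.inr)) := by
    have := hy
    rw [← p.maxFace_splitFace x (Sum.elim (s • (x ∘ Sum.inl)) (t • (x ∘ Sum.inr)))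
      (by simp [hs]) (by simp [ht])] at this
    simpa [dot_sum, smul_dotProduct] using this.2 w hw
  have hlim (A B : ℝ) (h : ∀ s : ℝ, 0 < s → A ≤ s * B) : A ≤ 0 := by
    by_contra! hA
    have h1 := h (A / (2 * (|B| + 1))) (by positivity)
    have h2 : A / (2 * (|B| + 1)) * B ≤ A / (2 * (|B| + 1)) * |B| :=
      mul_le_mul_of_nonneg_left (le_abs_self B) (by positivity)
    have h3 : A / (2 * (|B| + 1)) * (2 * (|B| + 1)) = A := div_mul_cancel₀ _ (by positivity)
    have h4 : 0 < A / (2 * (|B| + 1)) := by positivity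
    nlinarith
  have hleft : (x ∘ Sum.inl) ⬝ᵥ (a ∘ Sum.inl) ≤ (x ∘ Sum.inl) ⬝ᵥ (y ∘ Sum.inl) := by
    have := hlim _ ((x ∘ Sum.inr) ⬝ᵥ (y ∘ Sum.inr) - (x ∘ Sum.inr) ⬝ᵥ (a ∘ Sum.inr))
      fun t ht => by
        have := hscale 1 t one_pos ht a ha
        show (x ∘ Sum.inl) ⬝ᵥ (a ∘ Sum.inl) - (x ∘ Sum.inl) ⬝ᵥ (y ∘ Sum.inl) ≤ _
        linarith
    linarith
  have hright : (x ∘ Sum.inr) ⬝ᵥ (b ∘ Sum.inr) ≤ (x ∘ Sum.inr) ⬝ᵥ (y ∘ Sum.inr) := by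
    have := hlim _ ((x ∘ Sum.inl) ⬝ᵥ (y ∘ Sum.inl) - (x ∘ Sum.inl) ⬝ᵥ (b ∘ Sum.inl))
      fun t ht => by
        have := hscale t 1 ht one_pos b hb
        show (x ∘ Sum.inr) ⬝ᵥ (b ∘ Sum.inr) - (x ∘ Sum.inr) ⬝ᵥ (y ∘ Sum.inr) ≤ _
        linarith
    linarith
  simp only at hza hzb
  rw [dot_sum, dot_sum x y, ← hza, ← hzb]
  exact add_le_add hleft hright

/-- The product of generalized permutahedra. -/
def prod (p : GenPerm I) (q : GenPerm J) : GenPerm (I ⊕ J) where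
  carrier := prodSet p.carrier q.carrier
  isPolytope := p.isPolytope.prod q.isPolytope
  coarsens := by
    rw [coarsens_iff]
    intro x y h
    rw [maxFace_prod, maxFace_prod, p.maxFace_eq (x ∘ Sum.inl) (y ∘ Sum.inl) fun i j => h _ _,
      q.maxFace_eq (x ∘ Sum.inr) (y ∘ Sum.inr) fun i j => h _ _]

/-- Relabelling of coordinates along a bijection. -/
def relabel (σ : I ≃ J) (p : GenPerm I) : GenPerm J where
  carrier := relabelSet σ p.carrier
  isPolytope := p.isPolytope.relabel σ
  coarsens := by
    rw [coarsens_iff]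
    intro x y h
    rw [maxFace_relabel, maxFace_relabel, p.maxFace_eq (x ∘ σ) (y ∘ σ) fun i j => h _ _]

/-- The unique generalized permutahedron in `ℝ^∅`: a point. -/
def point : GenPerm PEmpty.{u + 1} where
  carrier := Set.univ
  isPolytope := ⟨{0}, Set.finite_singleton 0, Set.singleton_nonempty 0, by
    ext x; simp [Subsingleton.elim x 0]⟩
  coarsens := by
    rw [coarsens_iff]
    intro x y _
    rw [Subsingleton.elim x y]

theorem eq_point (p : GenPerm PEmpty.{u + 1}) : p = point := by
  apply ext_carrier
  obtain ⟨y, hy⟩ := p.isPolytope.nonempty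
  ext x
  simp [point, Subsingleton.elim x y, hy]

theorem carrier_nonempty (p : GenPerm I) : p.carrier.Nonempty := p.isPolytope.nonempty

section Laws

variable {I' J' : Type u} [Fintype I'] [Fintype J']

theorem splitFace_relabel (σ : I ≃ I') (τ : J ≃ J') (p : GenPerm (I ⊕ J)) :
    (p.relabel (Equiv.sumCongr σ τ)).splitFace = relabelSet (Equiv.sumCongr σ τ) p.splitFace := by
  simp only [splitFace, relabel, maxFace_relabel]
  congr 2
  ext (i | i) <;> simp

theorem restrict_relabel (σ : I ≃ I') (τ : J ≃ J') (p : GenPerm (I ⊕ J)) :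
    (p.relabel (Equiv.sumCongr σ τ)).restrict = p.restrict.relabel σ := by
  apply ext_carrier
  simp only [restrict, splitFace_relabel]
  ext z
  constructor
  · rintro ⟨y, hy, rfl⟩
    exact ⟨_, hy, by ext; simp⟩
  · rintro ⟨y, hy, h⟩
    refine ⟨y ∘ (Equiv.sumCongr σ τ).symm, ?_, ?_⟩
    · exact comp_symm_mem_relabelSet _ hy
    · ext i
      simpa using congrFun h (σ.symm i)

theorem contract_relabel (σ : I ≃ I') (τ : J ≃ J') (p : GenPerm (I ⊕ J)) :
    (p.relabel (Equiv.sumCongr σ τ)).contract = p.contract.relabel τ := by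
  apply ext_carrier
  simp only [contract, splitFace_relabel]
  ext z
  constructor
  · rintro ⟨y, hy, rfl⟩
    exact ⟨_, hy, by ext; simp⟩
  · rintro ⟨y, hy, h⟩
    refine ⟨y ∘ (Equiv.sumCongr σ τ).symm, ?_, ?_⟩
    · exact comp_symm_mem_relabelSet _ hy
    · ext i
      simpa using congrFun h (τ.symm i)

/-- Both iterated splittings of `p` give the same face. -/
theorem iterated_face (p : GenPerm ((I ⊕ J) ⊕ K)) :
    relabelSet (Equiv.sumAssoc I J K) (prodSet p.restrict.splitFace p.contract.carrier) =
      prodSet (p.relabel (Equiv.sumAssoc I J K)).restrict.carrier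
        (p.relabel (Equiv.sumAssoc I J K)).contract.splitFace := by
  let u : (I ⊕ J) ⊕ K → ℝ := Sum.elim (fun _ => 1) (fun _ => 0)
  let v : (I ⊕ J) ⊕ K → ℝ := Sum.elim (Sum.elim (fun _ => 1) (fun _ => 0)) (fun _ => 0)
  let v' : (I ⊕ J) ⊕ K → ℝ := Sum.elim (Sum.elim (fun _ => 0) (fun _ => 1)) (fun _ => 0)
  have h₁ : prodSet p.restrict.splitFace p.contract.carrier = maxFace (maxFace p.carrier u) v := by
    change _ = maxFace p.splitFace v
    rw [splitFace_eq p, maxFace_prod]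
    congr 1
    exact (maxFace_zero _).symm
  have h₂ : prodSet (p.relabel (Equiv.sumAssoc I J K)).restrict.carrier
      (p.relabel (Equiv.sumAssoc I J K)).contract.splitFace =
      relabelSet (Equiv.sumAssoc I J K) (maxFace (maxFace p.carrier v) v') := by
    have e₁ : (p.relabel (Equiv.sumAssoc I J K)).splitFace =
        relabelSet (Equiv.sumAssoc I J K) (maxFace p.carrier v) := by
      simp only [splitFace, relabel, maxFace_relabel]
      congr 2
      ext ((i | i) | i) <;> simp [v]
    have e₂ : v' = (Sum.elim 0 (Sum.elim (fun _ => 1) (fun _ => 0)) : I ⊕ (J ⊕ K) → ℝ) ∘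
        (Equiv.sumAssoc I J K) := by
      ext ((i | i) | i) <;> simp [v']
    rw [e₂, ← maxFace_relabel, ← e₁, splitFace_eq (p.relabel _), maxFace_prod]
    congr 1
    exact (maxFace_zero _).symm
  have hne := p.isPolytope.maxFace_nonempty (u + (1 / 2 : ℝ) • v)
  rw [h₁, h₂, maxFace_maxFace p.carrier _ u v 1 one_pos hne, 
    maxFace_maxFace p.carrier _ v v' 1 one_pos hne]
  all_goals
    intro ε h₀ h₁
    apply p.maxFace_eq
    rintro ((i | i) | i) ((j | j) | j) <;> simp [u, v, v'] <;> norm_num <;> linarith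

theorem restrict_restrict (p : GenPerm ((I ⊕ J) ⊕ K)) :
    p.restrict.restrict = (p.relabel (Equiv.sumAssoc I J K)).restrict := by
  apply ext_carrier
  have h := congrArg projLeft p.iterated_face
  rw [projLeft_prodSet (splitFace_isPolytope _).nonempty] at h
  rw [← h]
  change projLeft _ = _
  conv_lhs => rw [← projLeft_prodSet (A := p.restrict.splitFace) p.contract.carrier_nonempty]
  ext z
  constructor
  · rintro ⟨_, ⟨y, hy, rfl⟩, rfl⟩
    refine ⟨y ∘ (Equiv.sumAssoc I J K).symm, ?_, ?_⟩
    · exact comp_symm_mem_relabelSet _ hy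
    · ext; simp
  · rintro ⟨y, hy, rfl⟩
    exact ⟨_, ⟨_, hy, rfl⟩, by ext; simp⟩

theorem contract_restrict (p : GenPerm ((I ⊕ J) ⊕ K)) :
    p.restrict.contract = (p.relabel (Equiv.sumAssoc I J K)).contract.restrict := by
  apply ext_carrier
  have h := congrArg (fun A => projLeft (projRight A)) p.iterated_face
  simp only [projRight_prodSet (carrier_nonempty _)] at h
  change projRight _ = projLeft _
  rw [← h]
  conv_lhs => rw [← projLeft_prodSet (A := p.restrict.splitFace) p.contract.carrier_nonempty]
  ext z
  constructor
  · rintro ⟨_, ⟨y, hy, rfl⟩, rfl⟩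
    refine ⟨_, ⟨y ∘ (Equiv.sumAssoc I J K).symm, ?_, rfl⟩, ?_⟩
    · exact comp_symm_mem_relabelSet _ hy
    · ext; simp
  · rintro ⟨_, ⟨y, hy, rfl⟩, rfl⟩
    exact ⟨_, ⟨_, hy, rfl⟩, by ext; simp⟩

theorem contract_contract (p : GenPerm ((I ⊕ J) ⊕ K)) :
    p.contract = (p.relabel (Equiv.sumAssoc I J K)).contract.contract := by
  apply ext_carrier
  have h := congrArg (fun A => projRight (projRight A)) p.iterated_face
  simp only [projRight_prodSet (carrier_nonempty _)] at h
  change _ = projRight _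
  rw [← h]
  conv_lhs => rw [← projRight_prodSet (B := p.contract.carrier)
    p.restrict.splitFace_isPolytope.nonempty]
  ext z
  constructor
  · rintro ⟨y, hy, rfl⟩
    refine ⟨_, ⟨y ∘ (Equiv.sumAssoc I J K).symm, ?_, rfl⟩, ?_⟩
    · exact comp_symm_mem_relabelSet _ hy
    · ext; simp
  · rintro ⟨_, ⟨y, hy, rfl⟩, rfl⟩
    exact ⟨_, hy, by ext; simp⟩

theorem splitFace_prod {A B C D : Type u} [Fintype A] [Fintype B] [Fintype C] [Fintype D]
    (p : GenPerm (A ⊕ B)) (q : GenPerm (C ⊕ D)) :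
    ((p.prod q).relabel (Equiv.sumSumSumComm A B C D)).splitFace =
      relabelSet (Equiv.sumSumSumComm A B C D) (prodSet p.splitFace q.splitFace) := by
  simp only [splitFace, relabel, prod, maxFace_relabel, maxFace_prod]
  congr 3 <;> ext (i | i) <;> simp

theorem restrict_prod {A B C D : Type u} [Fintype A] [Fintype B] [Fintype C] [Fintype D]
    (p : GenPerm (A ⊕ B)) (q : GenPerm (C ⊕ D)) :
    ((p.prod q).relabel (Equiv.sumSumSumComm A B C D)).restrict = p.restrict.prod q.restrict := by
  apply ext_carrier
  change projLeft _ = prodSet (projLeft _) (projLeft _)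
  rw [splitFace_prod]
  ext z
  constructor
  · rintro ⟨y, ⟨hy, hy'⟩, rfl⟩
    exact ⟨⟨_, hy, by ext; simp⟩, ⟨_, hy', by ext; simp⟩⟩
  · rintro ⟨⟨a, ha, hza⟩, ⟨b, hb, hzb⟩⟩
    refine ⟨Sum.elim a b ∘ (Equiv.sumSumSumComm A B C D).symm, ⟨?_, ?_⟩, ?_⟩
    · convert ha using 1; ext (i | i) <;> rfl
    · convert hb using 1; ext (i | i) <;> rfl
    · ext (i | i)
      · simpa using congrFun hza i
      · simpa using congrFun hzb i

theorem contract_prod {A B C D : Type u} [Fintype A] [Fintype B] [Fintype C] [Fintype D]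
    (p : GenPerm (A ⊕ B)) (q : GenPerm (C ⊕ D)) :
    ((p.prod q).relabel (Equiv.sumSumSumComm A B C D)).contract = p.contract.prod q.contract := by
  apply ext_carrier
  change projRight _ = prodSet (projRight _) (projRight _)
  rw [splitFace_prod]
  ext z
  constructor
  · rintro ⟨y, ⟨hy, hy'⟩, rfl⟩
    exact ⟨⟨_, hy, by ext; simp⟩, ⟨_, hy', by ext; simp⟩⟩
  · rintro ⟨⟨a, ha, hza⟩, ⟨b, hb, hzb⟩⟩
    refine ⟨Sum.elim a b ∘ (Equiv.sumSumSumComm A B C D).symm, ⟨?_, ?_⟩, ?_⟩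
    · convert ha using 1; ext (i | i) <;> rfl
    · convert hb using 1; ext (i | i) <;> rfl
    · ext (i | i)
      · simpa using congrFun hza i
      · simpa using congrFun hzb i

theorem contract_empty (p : GenPerm (PEmpty.{u + 1} ⊕ I)) :
    p.contract = p.relabel (Equiv.emptySum PEmpty I) := by
  apply ext_carrier
  have h : p.splitFace = p.carrier := by
    conv_rhs => rw [← maxFace_zero p.carrier]
    rw [splitFace]; congr 1; ext (i | i) <;> simp; exact i.elim
  change projRight _ = relabelSet _ _
  rw [h]
  ext z
  constructor
  · rintro ⟨y, hy, rfl⟩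
    have e : (y ∘ Sum.inr) ∘ Equiv.emptySum PEmpty I = y := by
      ext (i | i)
      · exact i.elim
      · simp
    exact (congrArg (· ∈ p.carrier) e).mpr hy
  · intro hz
    exact ⟨_, hz, by ext; simp⟩

theorem restrict_empty (p : GenPerm (I ⊕ PEmpty.{u + 1})) :
    p.restrict = p.relabel (Equiv.sumEmpty I PEmpty) := by
  apply ext_carrier
  have h : p.splitFace = p.carrier := by
    conv_rhs => rw [← maxFace_zero p.carrier]
    apply p.maxFace_eq
    rintro (i | i) (j | j)
    · simp
    · exact j.elim
    · exact i.elim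
    · exact i.elim
  change projLeft _ = relabelSet _ _
  rw [h]
  ext z
  constructor
  · rintro ⟨y, hy, rfl⟩
    have e : (y ∘ Sum.inl) ∘ Equiv.sumEmpty I PEmpty = y := by
      ext (i | i)
      · simp
      · exact i.elim
    exact (congrArg (· ∈ p.carrier) e).mpr hy
  · intro hz
    exact ⟨_, hz, by ext; simp⟩

theorem prod_relabel (σ : I ≃ I') (τ : J ≃ J') (p : GenPerm I) (q : GenPerm J) :
    (p.prod q).relabel (Equiv.sumCongr σ τ) = (p.relabel σ).prod (q.relabel τ) := rfl

theorem prod_assoc (p : GenPerm I) (q : GenPerm J) (r : GenPerm K) :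
    ((p.prod q).prod r).relabel (Equiv.sumAssoc I J K) = p.prod (q.prod r) := by
  apply ext_carrier
  ext z
  exact and_assoc

theorem point_prod (p : GenPerm I) :
    (point.prod p).relabel (Equiv.emptySum PEmpty I) = p := by
  apply ext_carrier
  ext z
  exact iff_of_eq (true_and _)

theorem prod_point (p : GenPerm I) :
    (p.prod point).relabel (Equiv.sumEmpty I PEmpty) = p := by
  apply ext_carrier
  ext z
  exact iff_of_eq (and_true _)

end Laws

end GenPerm

variable (k : Type v) [Field k]

/-- The vector space spanned by the generalized permutahedra in `ℝ^I`. -/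
abbrev GenPermSpace (I : Type u) [Fintype I] : Type (max u v) := GenPerm I →₀ k

namespace GenPermSpace

/-- Relabelling, extended linearly. -/
noncomputable def map (σ : I ≃ J) : GenPermSpace k I →ₗ[k] GenPermSpace k J :=
  Finsupp.lmapDomain k k (GenPerm.relabel σ)

/-- The product `p ⊗ q ↦ p × q`. -/
noncomputable def mul (I J : Type u) [Fintype I] [Fintype J] :
    GenPermSpace k I ⊗[k] GenPermSpace k J →ₗ[k] GenPermSpace k (I ⊕ J) :=
  TensorProduct.lift (Finsupp.lift _ k _ fun p : GenPerm I => Finsupp.lift _ k _ fun q : GenPerm J =>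
    Finsupp.single (p.prod q) 1)

/-- The coproduct `p ↦ p|I ⊗ p/I`. -/
noncomputable def comul (I J : Type u) [Fintype I] [Fintype J] :
    GenPermSpace k (I ⊕ J) →ₗ[k] GenPermSpace k I ⊗[k] GenPermSpace k J :=
  Finsupp.lift _ k _ fun p : GenPerm (I ⊕ J) =>
    Finsupp.single p.restrict 1 ⊗ₜ[k] Finsupp.single p.contract 1

/-- The counit, with value `1` on the point. -/
noncomputable def counit : GenPermSpace k PEmpty.{u + 1} →ₗ[k] k :=
  Finsupp.lift _ k _ fun _ => 1

theorem map_single (σ : I ≃ J) (p : GenPerm I) (r : k) :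
    map k σ (Finsupp.single p r) = Finsupp.single (p.relabel σ) r := by
  simp [map]

theorem mul_single (p : GenPerm I) (q : GenPerm J) (r s : k) :
    mul k I J (Finsupp.single p r ⊗ₜ Finsupp.single q s) =
      Finsupp.single (p.prod q) (r * s) := by
  simp [mul]

theorem comul_single (p : GenPerm (I ⊕ J)) (r : k) :
    comul k I J (Finsupp.single p r) =
      Finsupp.single p.restrict r ⊗ₜ[k] Finsupp.single p.contract 1 := by
  simp [comul, TensorProduct.smul_tmul']

theorem counit_single (p : GenPerm PEmpty.{u + 1}) (r : k) :
    counit k (Finsupp.single p r) = r := by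
  simp [counit]

end GenPermSpace

open GenPerm GenPermSpace in
/-- The Hopf monoid `GP` of generalized permutahedra. -/
@[reducible] noncomputable def GP : ConnectedHopfMonoid.{u, v, max u v} k where
  obj I _ := GenPermSpace k I
  map σ := GenPermSpace.map k σ
  mul I J _ _ := GenPermSpace.mul k I J
  one := Finsupp.single GenPerm.point 1
  comul I J _ _ := GenPermSpace.comul k I J
  counit := GenPermSpace.counit k
  map_refl I _ x := by
    induction x using Finsupp.induction_linear with
    | zero => simp
    | add x y hx hy => simp only [map_add, hx, hy]
    | single p r => rw [GenPermSpace.map_single]; rfl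
  map_trans σ τ x := by
    induction x using Finsupp.induction_linear with
    | zero => simp
    | add x y hx hy => simp only [map_add, hx, hy]
    | single p r => simp only [GenPermSpace.map_single]; rfl
  mul_natural σ τ x y := by
    induction x using Finsupp.induction_linear with
    | zero => simp
    | add x y hx hy => simp only [TensorProduct.add_tmul, map_add, hx, hy]
    | single p r =>
      induction y using Finsupp.induction_linear with
      | zero => simp
      | add x y hx hy => simp only [TensorProduct.tmul_add, map_add, hx, hy]
      | single q s => simp only [GenPermSpace.map_single, mul_single, prod_relabel]
  comul_natural σ τ x := by
    induction x using Finsupp.induction_linear with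
    | zero => simp
    | add x y hx hy => simp only [map_add, hx, hy]
    | single p r =>
      simp only [GenPermSpace.map_single, comul_single, TensorProduct.map_tmul, restrict_relabel,
        contract_relabel]
  mul_assoc I J K _ _ _ x y z := by
    induction x using Finsupp.induction_linear with
    | zero => simp
    | add x y hx hy => simp only [TensorProduct.add_tmul, map_add, hx, hy]
    | single p r =>
    induction y using Finsupp.induction_linear with
    | zero => simp
    | add x y hx hy => simp only [TensorProduct.add_tmul, TensorProduct.tmul_add, map_add, hx, hy]
    | single q s =>
    induction z using Finsupp.induction_linear with
    | zero => simp
    | add x y hx hy => simp only [TensorProduct.tmul_add, map_add, hx, hy]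
    | single t c => simp only [GenPermSpace.map_single, mul_single, prod_assoc, _root_.mul_assoc]
  one_mul I _ x := by
    induction x using Finsupp.induction_linear with
    | zero => simp
    | add x y hx hy => simp only [TensorProduct.tmul_add, map_add, hx, hy]
    | single p r => simp only [GenPermSpace.map_single, mul_single, point_prod, _root_.one_mul]
  mul_one I _ x := by
    induction x using Finsupp.induction_linear with
    | zero => simp
    | add x y hx hy => simp only [TensorProduct.add_tmul, map_add, hx, hy]
    | single p r => simp only [GenPermSpace.map_single, mul_single, prod_point, _root_.mul_one]
  comul_coassoc I J K _ _ _ x := by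
    induction x using Finsupp.induction_linear with
    | zero => simp
    | add x y hx hy => simp only [map_add, hx, hy]
    | single p r =>
      simp only [GenPermSpace.map_single, comul_single, TensorProduct.map_tmul,
        TensorProduct.assoc_tmul, LinearMap.id_apply, restrict_restrict, contract_restrict,
        ← contract_contract]
  counit_comul I _ x := by
    induction x using Finsupp.induction_linear with
    | zero => simp
    | add x y hx hy => simp only [map_add, hx, hy]
    | single p r =>
      simp only [GenPermSpace.map_single, comul_single, TensorProduct.map_tmul, counit_single,
        TensorProduct.lid_tmul, LinearMap.id_apply, contract_empty, Finsupp.smul_single,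
        smul_eq_mul, _root_.mul_one]
  comul_counit I _ x := by
    induction x using Finsupp.induction_linear with
    | zero => simp
    | add x y hx hy => simp only [map_add, hx, hy]
    | single p r =>
      simp only [GenPermSpace.map_single, comul_single, TensorProduct.map_tmul, counit_single,
        TensorProduct.rid_tmul, LinearMap.id_apply, restrict_empty, one_smul]
  comul_mul A B C D _ _ _ _ x y := by
    induction x using Finsupp.induction_linear with
    | zero => simp
    | add x y hx hy => simp only [TensorProduct.add_tmul, map_add, hx, hy]
    | single p r =>
      induction y using Finsupp.induction_linear with
      | zero => simp
      | add x y hx hy => simp only [TensorProduct.tmul_add, map_add, hx, hy]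
      | single q s =>
        simp only [GenPermSpace.map_single, comul_single, mul_single, TensorProduct.map_tmul,
          TensorProduct.tensorTensorTensorComm_tmul, restrict_prod, contract_prod, _root_.mul_one]
  comul_one := by
    rw [GenPermSpace.map_single, comul_single, eq_point (restrict _), eq_point (contract _)]
  counit_mul x y := by
    induction x using Finsupp.induction_linear with
    | zero => simp
    | add x y hx hy => simp only [TensorProduct.add_tmul, map_add, hx, hy, add_mul]
    | single p r =>
      induction y using Finsupp.induction_linear with
      | zero => simp
      | add x y hx hy => simp only [TensorProduct.tmul_add, map_add, hx, hy, mul_add]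
      | single q s => simp only [GenPermSpace.map_single, mul_single, counit_single]
  counit_one := counit_single k _ _
  connected x := by
    induction x using Finsupp.induction_linear with
    | zero => simp
    | add x y hx hy => rw [map_add, add_smul, hx, hy]
    | single p r => simp [counit_single, eq_point p]

/-- The Hopf monoid `OGP` of ordered generalized permutahedra. -/
@[reducible] noncomputable def OGP : ConnectedHopfMonoid.{u, v, max u v} k := hadamard (LStar k) (GP k)

/-- The symmetrization map `GP[I] → OGP[I]`, `p ↦ ∑ w, w ⊗ p`. -/
noncomputable def symmetrization (I : Type u) [Fintype I] : (GP k).obj I →ₗ[k] (OGP k).obj I :=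
  Finsupp.lift (LinOrdSpace k I ⊗[k] GenPermSpace k I) k (GenPerm I) fun p =>
    ∑ w : LinearOrdering I, Finsupp.single w 1 ⊗ₜ[k] Finsupp.single p 1

end GeneralizedPermutahedra

/-! Write `s_I` for `allOrders k I`, the sum of all linear orders on `I`. Since every summand of the
symmetrization of `p` has the same right factor, bilinearity gives `Symm(x) = s_I ⊗ x` for every
vector `x` (`symmetrization_apply`). All operations of `OGP` are componentwise, so each morphism
axiom splits into a tautology in the factor `GP` and a statement about `s` in the factor `L*`: that
the family `s` is stable under relabelling, multiplicative (`s_I · s_J = s_{I ⊔ J}`), group-like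
(`Δ(s_{I ⊔ J}) = s_I ⊗ s_J`), and equal to the unit at the empty set. In other words, `1 ↦ s_I` is a
morphism to `L*` from the exponential Hopf monoid `E`, which has `E[I] = k`, and `Symm` is its
Hadamard product with the identity of `GP`, once `E × GP` is identified with `GP`.

The two essential facts are bijections on linear orders. Each order on `I ⊔ J` is a shuffle of
exactly one pair of orders, namely its two restrictions; this gives `mul_allOrders`. Each pair of
orders on `I` and `J` is the pair of restrictions of exactly one order with initial segment `I`,
namely the concatenation; this gives `comul_allOrders`. Both are proved through coefficients: `s_I`
is the constant function `1` on orders.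

Injectivity comes from the same constant: reading off the coefficient of one fixed order `w` in the
left factor sends `s_I ⊗ x` back to `x`. No polyhedral geometry enters here; it was all spent on
showing that `GP` is a Hopf monoid. -/

/-! ### The sum of all linear orders as a multiplicative, group-like family in `L*`. -/

namespace LinOrdSpace

variable (k : Type v) [Field k]

/-- The sum of all linear orders on `I`. -/
noncomputable def allOrders (I : Type u) [Fintype I] : LinOrdSpace k I :=
  ∑ w : LinearOrdering I, Finsupp.single w 1

variable {I J : Type u} [Fintype I] [Fintype J]

/-- Replaces the sum by the constant function `1`. The identities below then become comparisons of
coefficients, and no sum over orders has to be reindexed. -/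
theorem allOrders_apply (w : LinearOrdering I) : allOrders k I w = 1 := by
  classical
  simp [allOrders, Finsupp.finsetSum_apply, Finsupp.single_apply]

/-- Relabelling permutes the summands. In coefficients: pulling a constant function back along a
bijection leaves it constant. -/
theorem map_allOrders (σ : I ≃ J) : map k σ (allOrders k I) = allOrders k J := by
  ext w
  rw [map_apply, allOrders_apply, allOrders_apply]

/-- An order `v` on `I ⊔ J` occurs in the shuffle product of exactly one pair, `(v.left, v.right)`,
and with coefficient one. By `mul_apply` its coefficient here is therefore `1 * 1`. -/
theorem mul_allOrders : mul k I J (allOrders k I ⊗ₜ allOrders k J) = allOrders k (I ⊕ J) := by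
  ext v
  rw [mul_apply, allOrders_apply, allOrders_apply, allOrders_apply, mul_one]

/-- The orders in which `I` is not initial are sent to `0`, and those in which it is correspond to
pairs `(w, u)` by concatenation. So each `w ⊗ u` arises exactly once. -/
theorem comul_allOrders :
    comul k I J (allOrders k (I ⊕ J)) = allOrders k I ⊗ₜ allOrders k J := by
  -- Tensors of functions on orders are identified with functions on pairs of orders, so that both
  -- sides can be compared at each pair: the left side takes the value of `allOrders` at `w.concat
  -- u`, the right side a product of two values, all equal to `1`.
  apply (finsuppTensorFinsupp' k _ _).injective
  ext ⟨w, u⟩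
  rw [comul_coeff, finsuppTensorFinsupp'_apply_apply, allOrders_apply, allOrders_apply,
    allOrders_apply, mul_one]

/-- The sum has a single term, which is the unit of `L*`. This settles both the unit and the counit
axiom. -/
theorem allOrders_empty :
    allOrders k PEmpty.{u + 1} = Finsupp.single LinearOrdering.empty 1 := by
  ext w
  rw [allOrders_apply, LinearOrdering.eq_empty w, Finsupp.single_eq_same]

end LinOrdSpace

/-! ### Existence of a linear order. -/

namespace LinearOrdering

/-- Injectivity needs one order whose coefficient can be read off. The well-ordering theorem
supplies it for any type, so no enumeration of a finite set is required. -/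
instance {I : Type u} : Nonempty (LinearOrdering I) := by
  let _ : LinearOrder I := IsWellOrder.linearOrder WellOrderingRel
  exact ⟨⟨(· ≤ ·), inferInstance⟩⟩

end LinearOrdering

/-! ### Symmetrization as tensoring with the sum of all orders. -/

section Symmetrization

open LinOrdSpace

variable (k : Type v) [Field k]

/-- The sum over `w` involves only the left factor, so it can be collected there; the result is then
linear in `x`. Everything that follows uses this form in place of the definition. -/
theorem symmetrization_apply (I : Type u) [Fintype I] (x : GenPermSpace k I) :
    symmetrization k I x = allOrders k I ⊗ₜ[k] x := by
  induction x using Finsupp.induction_linear with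
  | zero => rw [map_zero, TensorProduct.tmul_zero]
  | add x y hx hy => rw [map_add, hx, hy, TensorProduct.tmul_add]
  | single p r =>
    -- On a scaled basis vector, the sum is pulled into the left factor and the scalar `r` is moved
    -- across to the right one, where it turns `single p 1` into `single p r`.
    rw [symmetrization, Finsupp.lift_apply, Finsupp.sum_single_index (by exact zero_smul k _),
      ← TensorProduct.sum_tmul, ← allOrders, ← TensorProduct.tmul_smul, Finsupp.smul_single,
      smul_eq_mul, mul_one]

theorem symmetrization_injective (I : Type u) [Fintype I] :
    Function.Injective (symmetrization k I) := by
  obtain ⟨w⟩ : Nonempty (LinearOrdering I) := inferInstance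
  -- The left inverse takes the coefficient of the chosen `w`, which is `1` over every field. Adding
  -- up all coefficients instead would multiply `x` by `|I|!`, which can vanish in positive
  -- characteristic.
  refine Function.LeftInverse.injective (g := fun t : LinOrdSpace k I ⊗[k] GenPermSpace k I =>
    TensorProduct.lid k _ (TensorProduct.map (Finsupp.lapply w) LinearMap.id t)) fun x => ?_
  have h := symmetrization_apply k I x
  simp only [h, TensorProduct.map_tmul, Finsupp.lapply_apply, allOrders_apply, LinearMap.id_apply,
    TensorProduct.lid_tmul, one_smul]

/-- With the image in the form `s_I ⊗ x`, each axiom is the corresponding property of `allOrders` in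
the left factor, while the right factor carries the structure map of `GP` unchanged. -/
theorem symmetrization_isHopfMorphism :
    IsHopfMorphism (GP.{u, v} k) (OGP.{u, v} k) (fun I _ => symmetrization k I) where
  natural {I J} _ _ σ x := by
    rw [symmetrization_apply, symmetrization_apply]
    -- The map of `OGP` acts factorwise on a pure tensor by definition, so only the left factors
    -- remain to be compared.
    exact congrArg (· ⊗ₜ[k] GenPermSpace.map k σ x) (map_allOrders k σ).symm
  map_mul I J _ _ x y := by
    rw [symmetrization_apply, symmetrization_apply, symmetrization_apply]
    -- Swapping the middle factors turns `(s_I ⊗ x) ⊗ (s_J ⊗ y)` into `(s_I ⊗ s_J) ⊗ (x ⊗ y)`; this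
    -- too holds by computation on pure tensors.
    exact congrArg (· ⊗ₜ[k] GenPermSpace.mul k I J (x ⊗ₜ y)) (mul_allOrders k).symm
  map_one := by
    rw [symmetrization_apply, allOrders_empty]
  map_comul I J _ _ x := by
    rw [symmetrization_apply]
    simp only [LinearMap.comp_apply, TensorProduct.map_tmul, LinearEquiv.coe_coe, comul_allOrders]
    -- For general `x` the coproduct is not a pure tensor, but both sides are linear in it. On `a ⊗
    -- b` the middle swap sends `(s_I ⊗ s_J) ⊗ (a ⊗ b)` to `(s_I ⊗ a) ⊗ (s_J ⊗ b)`, the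
    -- symmetrization of each factor.
    generalize GenPermSpace.comul k I J x = t
    induction t with
    | zero => simp
    | add a b ha hb => simp only [TensorProduct.tmul_add, map_add, ha, hb]
    | tmul a b =>
      rw [TensorProduct.tensorTensorTensorComm_tmul, TensorProduct.map_tmul,
        symmetrization_apply, symmetrization_apply]
  map_counit x := by
    rw [symmetrization_apply, allOrders_empty]
    -- The counit of `OGP` multiplies the two counits, and that of `L*` is `1` on the empty order.
    simp [LinOrdSpace.counit]

end Symmetrization

theorem theorem3p2 (k : Type v) [Field k] :
    IsHopfMorphism (GP.{u, v} k) (OGP.{u, v} k) (fun I _ => symmetrization k I) ∧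
      ∀ (I : Type u) [Fintype I], Function.Injective (symmetrization k I) :=
  ⟨symmetrization_isHopfMorphism k, fun I _ => symmetrization_injective k I⟩
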